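/- Let $\Gamma_M$ be a perfect matching graph: a connected trivalent ribbon graph $\Gamma$ (loops and multiple edges allowed; a single vertex-free circle is also allowed), given by cyclic orders of the half-edges at the vertices and signs $\pm1$ of the edges, together with a perfect matching $M=\{e_1<\dots<e_\ell\}$ of its underlying graph, such that only edges of $M$ may have sign $-1$ (carry a half-twist). Let $n\ge 1$ be an integer, $m=\lfloor n/2\rfloor$, and let $\Bbbk$ be a commutative ring with a chosen element $\sqrt n$ satisfying $(\sqrt n)^2=n$. For $\alpha\in\{0,1\}^{\ell}$ let $\Gamma_\alpha$ be the set of circles obtained by replacing each positive edge $e_i\in M$ by two strands running parallel to $e_i$ along its two sides if $\alpha_i=0$, and by two crossing strands if $\alpha_i=1$ (the other way round for a negative edge). Let $k_\alpha$ be the number of circles and $|\alpha|=\sum_i\alpha_i$. Let $V$ be the free $\Bbbk$-module with basis $1,x,\dots,x^{n-1}$, with $\deg x^a=m-a$. Put $C^{i,*}=\bigoplus_{|\alpha|=i}V^{\otimes k_\alpha}$, where $v\in V^{\otimes k_\alpha}$ has quantum degree $j=\deg v+m|\alpha|$. For $t\in\{0,n\}$ define a map $C^{i,*}\to C^{i+1,*}$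 as the sum, over all pairs $\alpha,\alpha'$ such that $\alpha'$ arises from $\alpha$ by changing one entry $\alpha_p=0$ to $1$, of $(-1)^{\alpha_1+\dots+\alpha_{p-1}}$ times the map that is the identity on the unchanged circles and is $$x^a\otimes x^b\mapsto x^{a+b-t},\qquad x^a\mapsto\sum_{b+c=a+2m-t}x^b\otimes x^c,\qquad x^a\mapsto\sqrt n\,x^{a+m-t}$$ on the changed ones, according to whether two circles are fused, a circle is split, or a circle acquires a double point; terms with an exponent outside $\{0,\dots,n-1\}$ are zero. Call this map $\partial$ for $t=0$ and $\widetilde\partial$ for $t=n$. Then $\partial$ and $\widetilde\partial$ are anticommuting differentials of bidegrees $(1,0)$ and $(1,n)$, and $\widehat\partial=\partial+\widetilde\partial$ (the analogue of $\partial$ for the algebra $\Bbbk[x]/(x^n-1)$ in place of $\Bbbk[x]/(x^n)$) is a differential that preserves the filtration by quantum degree $\ge j$. Let $CH_n^{i,j}(\Gamma_M;\Bbbk)$ be the homology of $(C^{*,*},\partial)$ (bigraded $n$-color homology), and $\widehat{CH}{}_n^{i}(\Gamma_M;\Bbbk)$ the homology of $(C^{*},\widehat\partial)$ (filtered $n$-color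 homology), with the filtration induced by quantum degree. Then the filtered complex $(C^*,\widehat\partial)$ gives rise to a spectral sequence $(E_r,d_r)_{r\ge0}$ of $\Bbbk$-modules, with $d_r$ of bidegree $(1,rn)$, such that 1. $E_0=C^{*,*}$ with $d_0=\partial$, and $E_1^{i,j}\cong CH_n^{i,j}(\Gamma_M;\Bbbk)$, with $d_1$ induced by $\widetilde\partial$; 2. $d_r=0$ for all sufficiently large $r$, and the stable page $E_\infty$ is isomorphic to the filtered $n$-color homology in the sense of convergence: $E_\infty^{i,j}$ is isomorphic to the $j$-th graded piece of the filtered module $\widehat{CH}{}_n^{i}(\Gamma_M;\Bbbk)$. In particular, if $\Bbbk$ is a field, then $\bigoplus_j E_\infty^{i,j}\cong\widehat{CH}{}_n^{i}(\Gamma_M;\Bbbk)$ for every $i$. -/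

import Mathlib

universe u v w

open CategoryTheory

/-! ### Ribbon graphs and perfect matching graphs -/

/-- A ribbon graph with vertex set `V` and edge set `E`, given by a signed rotation system.
The underlying graph is a multigraph (loops and multiple edges are allowed), together with
a number of vertex-free circles.  An edge `e` has the two ends (half-edges) `(e, false)` and
`(e, true)`.  `rot` sends a half-edge to the next one, counterclockwise, around its vertex.
`sign e = -1` means that the band of `e` carries a half-twist. -/
structure RibbonGraph (V : Type w) (E : Type v) where
  /-- the vertex at which a half-edge is attached -/
  vert : E × Bool → V
  /-- the cyclic orders of the half-edges around the vertices -/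
  rot : Equiv.Perm (E × Bool)
  vert_eq_iff : ∀ h h', vert h = vert h' ↔ rot.SameCycle h h'
  /-- the sign of an edge -/
  sign : E → ℤˣ
  /-- the number of vertex-free circles of the graph -/
  freeCircles : ℕ

namespace RibbonGraph

variable {V : Type w} {E : Type v}

/-- The underlying graph is connected, as a one-dimensional complex: either there are vertices,
any two of them are joined by a path of edges, and there is no vertex-free circle, or
the graph is a single vertex-free circle. -/
def Connected (Γ : RibbonGraph V E) : Prop :=
  (Nonempty V ∧ Γ.freeCircles = 0 ∧
    ∀ a b : V, Relation.EqvGen (fun x y => ∃ e, Γ.vert (e, false) = x ∧ Γ.vert (e, true) = y) a b) ∨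
  (IsEmpty V ∧ Γ.freeCircles = 1)

end RibbonGraph

/-- A (signed) perfect matching graph: a trivalent ribbon graph with a perfect
matching of the underlying graph, such that only matching edges may carry a half-twist.
It is enough to ask that exactly one half-edge at each vertex belongs to the matching: this says
that the vertex is incident to exactly one matching edge, and that this edge is not a loop. -/
structure PerfectMatchingGraph (V : Type w) (E : Type v) extends RibbonGraph V E where
  trivalent : ∀ x : V, Nat.card {h : E × Bool // vert h = x} = 3
  /-- the set of matching edges -/
  matching : Finset E
  perfect : ∀ x : V, ∃! h : E × Bool, vert h = x ∧ h.1 ∈ matching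
  sign_eq_one : ∀ e, e ∉ matching → sign e = 1

namespace PerfectMatchingGraph

variable {V : Type w} {E : Type v} (Γ : PerfectMatchingGraph V E)

theorem vert_rot (h : E × Bool) : Γ.vert (Γ.rot h) = Γ.vert h :=
  ((Γ.vert_eq_iff h (Γ.rot h)).2 ⟨1, by simp⟩).symm

theorem rot_rot_ne {h : E × Bool} : Γ.rot (Γ.rot h) ≠ h := by
  intro hh
  have key : ∀ h', Γ.vert h' = Γ.vert h → h' = h ∨ h' = Γ.rot h := by
    intro h' e
    obtain ⟨i, hi⟩ := (Γ.vert_eq_iff h h').1 e.symm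
    have h2 : (Γ.rot ^ (2 : ℤ)) h = h := by
      rw [zpow_two]; exact hh
    have h2i : ∀ m : ℤ, ((Γ.rot ^ (2 : ℤ)) ^ m) h = h := fun m =>
      Equiv.Perm.zpow_apply_eq_self_of_apply_eq_self h2 m
    rcases Int.even_or_odd' i with ⟨m, rfl | rfl⟩
    · left; rw [← hi, zpow_mul, h2i]
    · right; rw [← hi, add_comm, zpow_add, zpow_one, zpow_mul, Equiv.Perm.mul_apply, h2i]
  have h3 := Γ.trivalent (Γ.vert h)
  have hsub : {h' | Γ.vert h' = Γ.vert h} ⊆ ({h, Γ.rot h} : Set (E × Bool)) := fun h' e => key h' e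
  have h4 := Set.ncard_le_ncard hsub (Set.toFinite _)
  have h5 := Set.ncard_insert_le h {Γ.rot h}
  rw [Set.ncard_singleton] at h5
  have h6 : ({h' | Γ.vert h' = Γ.vert h} : Set (E × Bool)).ncard = 3 := h3
  omega

theorem rot_ne {h : E × Bool} : Γ.rot h ≠ h := by
  intro hh
  exact Γ.rot_rot_ne (by rw [hh, hh])

theorem rot_notMem {h : E × Bool} (hh : h.1 ∈ Γ.matching) : (Γ.rot h).1 ∉ Γ.matching := by
  intro h'
  exact Γ.rot_ne ((Γ.perfect (Γ.vert h)).unique ⟨Γ.vert_rot h, h'⟩ ⟨rfl, hh⟩)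

theorem rot_rot_notMem {h : E × Bool} (hh : h.1 ∈ Γ.matching) :
    (Γ.rot (Γ.rot h)).1 ∉ Γ.matching := by
  intro h'
  exact Γ.rot_rot_ne ((Γ.perfect (Γ.vert h)).unique
    ⟨(Γ.vert_rot _).trans (Γ.vert_rot h), h'⟩ ⟨rfl, hh⟩)

/-! ### The hypercube of states -/

/-- The matching edges. -/
abbrev MEdge : Type v := {e : E // e ∈ Γ.matching}

/-- A vertex of the hypercube of states: the set of matching edges that are given the
`1`-smoothing. -/
abbrev State : Type v := Finset Γ.MEdge

/-- The arcs from which the circles of a state are glued: the non-matching edges and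
the vertex-free circles. -/
abbrev Arc : Type v := {e : E // e ∉ Γ.matching} ⊕ Fin Γ.freeCircles

/-- The arc that follows the matching edge `e` counterclockwise at the end `(e, b)`. -/
def arcL (e : Γ.MEdge) (b : Bool) : Γ.Arc := Sum.inl ⟨(Γ.rot (e.1, b)).1, Γ.rot_notMem e.2⟩

/-- The arc that precedes the matching edge `e` counterclockwise at the end `(e, b)`. -/
def arcR (e : Γ.MEdge) (b : Bool) : Γ.Arc :=
  Sum.inl ⟨(Γ.rot (Γ.rot (e.1, b))).1, Γ.rot_rot_notMem e.2⟩

/-- The smoothing of `e` in the state `α` runs parallel to `e` along both of its sides: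
this is the `0`-smoothing of a positive edge and the `1`-smoothing of a negative edge.
Otherwise the two strands along `e` cross. -/
def Parallel (α : Γ.State) (e : Γ.MEdge) : Prop := e ∈ α ↔ Γ.sign e.1 = -1

/-- Two arcs are glued at a matching edge by the smoothings of the state `α`. -/
def Glued (α : Γ.State) (x y : Γ.Arc) : Prop :=
  ∃ e : Γ.MEdge,
    (Γ.Parallel α e ∧ ((x = Γ.arcL e false ∧ y = Γ.arcR e true) ∨
      (x = Γ.arcR e false ∧ y = Γ.arcL e true))) ∨
    (¬ Γ.Parallel α e ∧ ((x = Γ.arcL e false ∧ y = Γ.arcL e true) ∨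
      (x = Γ.arcR e false ∧ y = Γ.arcR e true)))

/-- The circles of the state `α`: the classes of arcs for the equivalence relation
generated by gluing. -/
def Circle (α : Γ.State) : Type v := Quot (Γ.Glued α)

/-- The circle of the state `α` that contains a given arc. -/
def circleOf (α : Γ.State) (x : Γ.Arc) : Γ.Circle α := Quot.mk _ x

instance [Finite E] (α : Γ.State) : Finite (Γ.Circle α) := inferInstanceAs (Finite (Quot _))

noncomputable instance [Finite E] (α : Γ.State) : Fintype (Γ.Circle α) := Fintype.ofFinite _

/-! ### The chain modules -/

/-- The basis of the chain module: a state, together with an exponent `0 ≤ a < n` for each of its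
circles.  The element with exponents `a` stands for the tensor product of the monomials `x ^ a` in
`V ^ ⊗ (circles)`, where `V = k[x]/(x ^ n)` (or `k[x]/(x ^ n - 1)`) has basis
`1, x, …, x ^ (n - 1)`. -/
@[ext]
structure EnhancedState (n : ℕ) where
  /-- the vertex of the hypercube -/
  state : Γ.State
  /-- the exponents of the monomials -/
  exponent : Γ.Circle state → Fin n

instance [Finite E] (n : ℕ) : Finite (Γ.EnhancedState n) :=
  Finite.of_injective
    (fun s => (⟨s.state, s.exponent⟩ : Σ α : Γ.State, (Γ.Circle α → Fin n)))
    (by rintro ⟨α, a⟩ ⟨β, b⟩ h; cases h; rfl)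

noncomputable instance [Finite E] (n : ℕ) : Fintype (Γ.EnhancedState n) := Fintype.ofFinite _

/-- The chain module `⨁ V_α`, over all states `α`, as coordinates in the monomial basis. -/
abbrev Chain (k : Type u) (n : ℕ) : Type (max u v) := Γ.EnhancedState n → k

variable {Γ}

/-- The homological degree, the number of `1`-smoothings. -/
def EnhancedState.hdeg {n : ℕ} (s : Γ.EnhancedState n) : ℤ := s.state.card

/-- The quantum degree `j = deg + m * |α|`, where `deg (x ^ a) = m - a` and `m = ⌊n / 2⌋`. -/
noncomputable def EnhancedState.qdeg [Finite E] {n : ℕ} (s : Γ.EnhancedState n) : ℤ :=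
  ∑ c : Γ.Circle s.state, (((n / 2 : ℕ) : ℤ) - ((s.exponent c : ℕ) : ℤ)) +
    ((n / 2 : ℕ) : ℤ) * (s.state.card : ℤ)

variable (Γ)

/-! ### The differentials -/

section Differentials

variable {k : Type u} [CommRing k] (n : ℕ) (sqrtn : k)

open Classical in
/-- The matrix coefficient of the map `V_α → V_α'` of the edge of the hypercube from `α = s.state`
to `α' = s'.state` at the matching edge `e`, between the basis elements `s` and `s'`.
Exponents on the circles away from `e` are unchanged.  At `e`, with `m = ⌊n / 2⌋`,
for `t = 0` (resp. `t = n`) the maps are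
* fusion of two circles: `x ^ a ⊗ x ^ b ↦ x ^ (a + b - t)`;
* splitting of a circle: `x ^ a ↦ ∑ x ^ b ⊗ x ^ c` over `b + c = a + 2 * m - t`;
* a new double point on a circle: `x ^ a ↦ √n * x ^ (a + m - t)`;
where only exponents in `{0, …, n - 1}` occur. -/
noncomputable def edgeCoeff (t : ℕ) (e : Γ.MEdge) (s s' : Γ.EnhancedState n) : k :=
  let p := Γ.circleOf s.state (Γ.arcL e false)
  let q := Γ.circleOf s.state (Γ.arcR e false)
  let p' := Γ.circleOf s'.state (Γ.arcL e false)
  let q' := Γ.circleOf s'.state (Γ.arcR e false)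
  if ∀ x : Γ.Arc, Γ.circleOf s.state x ≠ p → Γ.circleOf s.state x ≠ q →
      s'.exponent (Γ.circleOf s'.state x) = s.exponent (Γ.circleOf s.state x) then
    if p ≠ q ∧ p' = q' then
      if (s'.exponent p' : ℕ) + t = s.exponent p + s.exponent q then 1 else 0
    else if p = q ∧ p' ≠ q' then
      if (s'.exponent p' : ℕ) + s'.exponent q' + t = s.exponent p + 2 * (n / 2) then 1 else 0
    else if p = q ∧ p' = q' then
      if (s'.exponent p' : ℕ) + t = s.exponent p + n / 2 then sqrtn else 0
    else 0
  else 0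

variable [Fintype E] [LinearOrder E]

/-- The signed sum of the maps of all edges of the hypercube.  The sign of an edge at `e` is
`-1` to the number of `1`-smoothings at matching edges before `e`. -/
noncomputable def hypercubeMap (t : ℕ) : Γ.Chain k n →ₗ[k] Γ.Chain k n :=
  Matrix.mulVecLin (Matrix.of fun s' s : Γ.EnhancedState n =>
    ∑ e : Γ.MEdge,
      if e ∉ s.state ∧ s'.state = insert e s.state then
        (-1 : k) ^ (s.state.filter (· < e)).card * Γ.edgeCoeff n sqrtn t e s s'
      else 0)

/-- The differential `∂`. -/
noncomputable def del : Γ.Chain k n →ₗ[k] Γ.Chain k n := Γ.hypercubeMap n sqrtn 0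

/-- The differential `∂̃`. -/
noncomputable def delTilde : Γ.Chain k n →ₗ[k] Γ.Chain k n := Γ.hypercubeMap n sqrtn n

/-- The differential `∂̂ = ∂ + ∂̃`, given by the multiplication, shifted comultiplication and
multiplication by `√n * x ^ m` in `k[x]/(x ^ n - 1)`. -/
noncomputable def delHat : Γ.Chain k n →ₗ[k] Γ.Chain k n := Γ.del n sqrtn + Γ.delTilde n sqrtn

end Differentials

/-! ### Gradings, filtration and homology -/

section Homology

variable (k : Type u) [CommRing k] (n : ℕ)

/-- The chains in homological degree `i`. -/
def hpart (i : ℤ) : Submodule k (Γ.Chain k n) where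
  carrier := {f | ∀ s, f s ≠ 0 → s.hdeg = i}
  add_mem' {f g} hf hg s h := by
    by_cases h0 : f s = 0
    · exact hg s fun h1 => h (by simp [h0, h1])
    · exact hf s h0
  zero_mem' s h := absurd rfl h
  smul_mem' c f hf s h := hf s fun h0 => h (by simp [h0])

/-- The quantum filtration: the chains spanned by basis elements of quantum degree `≥ j`. -/
def filt [Finite E] (j : ℤ) : Submodule k (Γ.Chain k n) where
  carrier := {f | ∀ s, f s ≠ 0 → j ≤ s.qdeg}
  add_mem' {f g} hf hg s h := by
    by_cases h0 : f s = 0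
    · exact hg s fun h1 => h (by simp [h0, h1])
    · exact hf s h0
  zero_mem' s h := absurd rfl h
  smul_mem' c f hf s h := hf s fun h0 => h (by simp [h0])

/-- The bigraded piece `C^{i,j}`. -/
def bipart [Finite E] (i j : ℤ) : Submodule k (Γ.Chain k n) where
  carrier := {f | ∀ s, f s ≠ 0 → s.hdeg = i ∧ s.qdeg = j}
  add_mem' {f g} hf hg s h := by
    by_cases h0 : f s = 0
    · exact hg s fun h1 => h (by simp [h0, h1])
    · exact hf s h0
  zero_mem' s h := absurd rfl h
  smul_mem' c f hf s h := hf s fun h0 => h (by simp [h0])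

end Homology

end PerfectMatchingGraph

/-- The quotient `Z / (Z ∩ B)`, which is `Z / B` if `B ⊆ Z`. -/
abbrev SubQuot {k : Type u} [CommRing k] {M : Type v} [AddCommGroup M] [Module k M]
    (Z B : Submodule k M) : Type v := ↥Z ⧸ B.submoduleOf Z

namespace PerfectMatchingGraph

variable {V : Type w} {E : Type v} [Fintype E] [LinearOrder E] (Γ : PerfectMatchingGraph V E)
  {k : Type u} [CommRing k] (n : ℕ) (sqrtn : k)

/-- The cycles of bidegree `(i, j)` for `∂`. -/
noncomputable abbrev bicycles (i j : ℤ) : Submodule k (Γ.Chain k n) :=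
  LinearMap.ker (Γ.del n sqrtn) ⊓ Γ.bipart k n i j

/-- The bigraded `n`-color homology `CH^{i,j}`. -/
abbrev CH (i j : ℤ) : Type (max u v) :=
  SubQuot (Γ.bicycles n sqrtn i j) ((Γ.bipart k n (i - 1) j).map (Γ.del n sqrtn))

/-- The cycles of homological degree `i` for `∂̂`. -/
noncomputable abbrev hatCycles (i : ℤ) : Submodule k (Γ.Chain k n) :=
  LinearMap.ker (Γ.delHat n sqrtn) ⊓ Γ.hpart k n i

/-- The filtered `n`-color homology in homological degree `i`. -/
abbrev CHhat (i : ℤ) : Type (max u v) :=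
  SubQuot (Γ.hatCycles n sqrtn i) ((Γ.hpart k n (i - 1)).map (Γ.delHat n sqrtn))

/-- The quantum filtration on the filtered `n`-color homology: the classes of the cycles in `filt`. -/
noncomputable def CHhatFilt (i j : ℤ) : Submodule k (Γ.CHhat n sqrtn i) :=
  ((Γ.filt k n j).submoduleOf (Γ.hatCycles n sqrtn i)).map (Submodule.mkQ _)

end PerfectMatchingGraph

/-! ### The spectral sequence of a filtered complex -/

section FilteredComplex

variable {k : Type u} [CommRing k] {M : Type v} [AddCommGroup M] [Module k M]
  (d : M →ₗ[k] M) (C F : ℤ → Submodule k M) (n : ℕ)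

/-- `Z_r^{i,j}`: the chains of degree `i` and filtration `≥ j` whose differential has
filtration `≥ j + r n`.  Here `d` raises the degree (given by `C`) by one and respects the
decreasing filtration `F`. -/
def pageCycles (r i j : ℤ) : Submodule k M := C i ⊓ F j ⊓ (F (j + r * n)).comap d

/-- `B_r^{i,j}`: the elements of `Z_r^{i,j}` of filtration `≥ j + 1`, together with the boundaries of
filtration `≥ j` of chains of filtration `> j - r n`. -/
def pageBoundaries (r i j : ℤ) : Submodule k M :=
  (pageCycles d C F n r i j ⊓ F (j + 1)) ⊔ ((C (i - 1) ⊓ F (j - r * n + 1)).map d ⊓ F j)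

/-- The module `E_r^{i,j} = Z_r^{i,j} / B_r^{i,j}` of a filtered complex, with the pages numbered so
that `d_r` raises the filtration by `r n`. -/
abbrev FilteredPage (r i j : ℤ) : Type v :=
  SubQuot (pageCycles d C F n r i j) (pageBoundaries d C F n r i j)

/-- The class in `E_r^{i,j}` of an element of `Z_r^{i,j}`. -/
def pageClass {r i j : ℤ} (x : ↥(pageCycles d C F n r i j)) : FilteredPage d C F n r i j :=
  Submodule.Quotient.mk x

/-- The shapes of the pages: `d_r` has bidegree `(1, r n)`. -/
abbrev colorShape (n : ℕ) (r : ℤ) : ComplexShape (ℤ × ℤ) :=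
  ComplexShape.up' ((1, r * n) : ℤ × ℤ)

/-- `S` is the spectral sequence of the filtered complex `(M, d, C, F)`: its pages are
`Z_r / B_r`, the differential of a page and the identification of its homology with the next page
being induced by `d` and by the inclusion of `Z_{r+1}` in `Z_r`. -/
def IsSpectralSequenceOfFiltered (S : SpectralSequence (ModuleCat.{v} k) (colorShape n) 0) : Prop :=
  ∃ φ : ∀ (r : ℤ) (hr : 0 ≤ r) (i j : ℤ), (S.page r hr).X (i, j) ≃ₗ[k] FilteredPage d C F n r i j,
    (∀ (r : ℤ) (hr : 0 ≤ r) (i j : ℤ) (x : ↥(pageCycles d C F n r i j))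
      (y : ↥(pageCycles d C F n r (i + 1) (j + r * n))), (y : M) = d x →
        φ r hr (i + 1) (j + r * n) (((S.page r hr).d (i, j) (i + 1, j + r * n)).hom
          ((φ r hr i j).symm (pageClass d C F n x))) = pageClass d C F n y) ∧
    (∀ (r : ℤ) (hr : 0 ≤ r) (hr' : 0 ≤ r + 1) (i j : ℤ) (c : ((S.page r hr).cycles (i, j) : ModuleCat k))
      (x : ↥(pageCycles d C F n r i j)) (x' : ↥(pageCycles d C F n (r + 1) i j)), (x' : M) = x →
        φ r hr i j (((S.page r hr).iCycles (i, j)).hom c) = pageClass d C F n x →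
        φ (r + 1) hr' i j ((S.iso r (r + 1) (i, j) rfl hr).hom.hom
          (((S.page r hr).homologyπ (i, j)).hom c)) = pageClass d C F n x')

end FilteredComplex

/-!
# The spectral sequence of the filtered `n`-color complex

**The differentials.** All of `∂ ∘ ∂ = 0`, `∂̃ ∘ ∂̃ = 0` and `∂̃ ∘ ∂ + ∂ ∘ ∂̃ = 0` are the homogeneous
components of `∂̂ ∘ ∂̂ = 0`, because `∂` and `∂̃` raise the quantum degree by `0` and `n`
(`del_delTilde_identities`).  The entries of the matrix of `∂̂` are polynomials in `√n` with integer
coefficients, so `∂̂ ∘ ∂̂ = 0` may be checked over `ℂ`, for both square roots of `n`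
(`Polynomial.aeval_eq_zero_of_sqrt`).  Over `ℂ`, the algebra `k[x]/(x ^ n - 1)` is a product of fields,
and the maps of the hypercube become diagonal in the basis of characters.  A character of a state is
a labelling of its circles by `n`-th roots of unity, which is seen here as a labelling of the arcs.
The map of an edge of the hypercube at `e` preserves a labelling if the two sides of `e` have the same
label, and annihilates it otherwise.  If every circle with the label `z` gets the weight
`√n * z ^ m`, then, once the characters are divided by their weights, the only factor that is left is
the weight `√n * z ^ m` of the label at `e` (`sum_character_mul_edgeCoeff`), which does not depend on
the states.  So the faces of the hypercube commute up to the signs, which makes them cancel in pairs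
(`pairing_delHat_delHat`), and characters separate chains by Fourier inversion
(`eq_zero_of_sum_character_eq_zero`).  The only geometric input is that the two
sides of a matching edge cannot lie on different circles both before and after the change of its
smoothing (`circleOf_eq_or_insert`), by a parity argument on the ends of the arcs (`even_ends`).

**The spectral sequence.** Here `d_r` raises the filtration degree by `r * n`, rather than by `r`.  This is
the usual spectral sequence of a filtered complex, reindexed; it exists because `∂̂` preserves the quantum
degree modulo `n`, so the complex splits by residue classes (`IsResidueSplit`).  With the
projections to the residue classes, the classical argument shows that `Z_{r+1}` maps onto the
homology of `E_r` with kernel `B_{r+1}` (`exists_mem_pageCycles_succ`, `mem_pageBoundaries_succ_iff`).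
Taking components of lowest degree identifies `E_0` and `E_1`.  The filtration is finite, so for large
`r` both `E_r^{i,j}` and the graded piece of the homology are quotients of the cycles in `F j` by the same
submodule (`nonempty_page_equiv_graded`); over a field a finite filtration splits
(`nonempty_directSum_subQuot_equiv`).
-/

/-! ### The spectral sequence of a filtered complex that splits by residue classes -/

section FilteredComplex

variable {k : Type u} [CommRing k] {M : Type v} [AddCommGroup M] [Module k M]

/-- `(M, d)` is a cochain complex graded by `C`, with a decreasing filtration `F` by
subcomplexes. -/
structure IsFilteredComplex (d : M →ₗ[k] M) (C F : ℤ → Submodule k M) : Prop where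
  d_d : ∀ x, d (d x) = 0
  d_mem_C : ∀ {i x}, x ∈ C i → d x ∈ C (i + 1)
  d_mem_F : ∀ {j x}, x ∈ F j → d x ∈ F j
  antitone : Antitone F

/-- The filtered complex splits by the residue modulo `n` of the filtration degree: `π j` is
the projection to the summand of the residue class of `j`.  It commutes with all of the structure,
it is the identity on `F j / F (j + 1)`, and on its image the filtration jumps only in degrees
congruent to `j`. -/
structure IsResidueSplit (d : M →ₗ[k] M) (C F : ℤ → Submodule k M) (n : ℕ)
    (π : ℤ → M →ₗ[k] M) : Prop extends IsFilteredComplex d C F where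
  pos : 0 < n
  proj_d : ∀ j x, π j (d x) = d (π j x)
  proj_mem_C : ∀ {i : ℤ} {x : M} (j : ℤ), x ∈ C i → π j x ∈ C i
  proj_mem_F : ∀ {j' : ℤ} {x : M} (j : ℤ), x ∈ F j' → π j x ∈ F j'
  proj_mem_F_add : ∀ {j : ℤ} {x : M} (q : ℤ), x ∈ F (j + q * n + 1) → π j x ∈ F (j + (q + 1) * n)
  sub_proj_mem : ∀ {j x}, x ∈ F j → x - π j x ∈ F (j + 1)

variable {d : M →ₗ[k] M} {C F : ℤ → Submodule k M} {n : ℕ} {π : ℤ → M →ₗ[k] M}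

theorem mem_pageCycles {r i j : ℤ} {x : M} :
    x ∈ pageCycles d C F n r i j ↔ x ∈ C i ∧ x ∈ F j ∧ d x ∈ F (j + r * n) := by
  simp [pageCycles, and_assoc]

theorem mem_pageBoundaries {r i j : ℤ} {x : M} :
    x ∈ pageBoundaries d C F n r i j ↔
      ∃ y, (y ∈ pageCycles d C F n r i j ∧ y ∈ F (j + 1)) ∧
        ∃ w, (w ∈ C (i - 1) ∧ w ∈ F (j - r * n + 1)) ∧ d w ∈ F j ∧ y + d w = x := by
  simp only [pageBoundaries, Submodule.mem_sup, Submodule.mem_inf, Submodule.mem_map]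
  constructor
  · rintro ⟨y, hy, z, ⟨⟨w, hw, rfl⟩, hz⟩, rfl⟩
    exact ⟨y, hy, w, hw, hz, rfl⟩
  · rintro ⟨y, hy, w, hw, hz, rfl⟩
    exact ⟨y, hy, d w, ⟨⟨w, hw, rfl⟩, hz⟩, rfl⟩

namespace IsFilteredComplex

variable (h : IsFilteredComplex d C F)

include h in
theorem d_mem_pageCycles {r i j i' j' : ℤ} (hi : i + 1 = i') (hj : j + r * n = j') {x : M}
    (hx : x ∈ pageCycles d C F n r i j) : d x ∈ pageCycles d C F n r i' j' := by
  subst hi hj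
  rw [mem_pageCycles] at hx ⊢
  refine ⟨h.d_mem_C hx.1, hx.2.2, ?_⟩
  rw [h.d_d]
  exact zero_mem _

include h in
theorem d_mem_pageBoundaries {r i j i' j' : ℤ} (hi : i + 1 = i') (hj : j + r * n = j') {x : M}
    (hx : x ∈ pageBoundaries d C F n r i j) : d x ∈ pageBoundaries d C F n r i' j' := by
  subst hi hj
  obtain ⟨y, ⟨hy, hy'⟩, w, hw, hdw, rfl⟩ := mem_pageBoundaries.1 hx
  rw [mem_pageCycles] at hy
  refine mem_pageBoundaries.2 ⟨0, ⟨zero_mem _, zero_mem _⟩, y, ⟨?_, ?_⟩, hy.2.2, ?_⟩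
  · simpa using hy.1
  · simpa using hy'
  · simp [h.d_d]

/-- The map `Z_r^{i,j} → Z_r^{i+1,j+rn}` induced by `d`. -/
def cyclesMap {r i j i' j' : ℤ} (hi : i + 1 = i') (hj : j + r * n = j') :
    ↥(pageCycles d C F n r i j) →ₗ[k] ↥(pageCycles d C F n r i' j') :=
  d.restrict fun _ => h.d_mem_pageCycles hi hj

/-- The differential `d_r : E_r^{i,j} → E_r^{i+1,j+rn}`. -/
def pageMap {r i j i' j' : ℤ} (hi : i + 1 = i') (hj : j + r * n = j') :
    FilteredPage d C F n r i j →ₗ[k] FilteredPage d C F n r i' j' :=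
  Submodule.mapQ _ _ (h.cyclesMap hi hj) fun _ hx => h.d_mem_pageBoundaries hi hj hx

theorem pageClass_surjective {r i j : ℤ} (c : FilteredPage d C F n r i j) :
    ∃ x, pageClass d C F n x = c := Submodule.Quotient.mk_surjective _ c

theorem pageClass_eq_iff {r i j : ℤ} {x y : ↥(pageCycles d C F n r i j)} :
    pageClass d C F n x = pageClass d C F n y ↔ (x - y : M) ∈ pageBoundaries d C F n r i j :=
  Submodule.Quotient.eq _

theorem pageClass_eq_zero_iff {r i j : ℤ} {x : ↥(pageCycles d C F n r i j)} :
    pageClass d C F n x = 0 ↔ (x : M) ∈ pageBoundaries d C F n r i j :=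
  Submodule.Quotient.mk_eq_zero _

open Classical in
/-- The page `E_r` as a complex. -/
noncomputable def page (n : ℕ) (r : ℤ) : HomologicalComplex (ModuleCat.{v} k) (colorShape n r) where
  X a := ModuleCat.of k (FilteredPage d C F n r a.1 a.2)
  d a b := if hab : a.1 + 1 = b.1 ∧ a.2 + r * n = b.2 then
    ModuleCat.ofHom (h.pageMap hab.1 hab.2) else 0
  shape a b hab := by
    rw [dif_neg]
    exact fun h' => hab (Prod.ext h'.1 h'.2)
  d_comp_d' a b c hab hbc := by
    obtain ⟨h1, h2⟩ := Prod.ext_iff.1 hab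
    obtain ⟨h3, h4⟩ := Prod.ext_iff.1 hbc
    rw [dif_pos ⟨h1, h2⟩, dif_pos ⟨h3, h4⟩, ← ModuleCat.ofHom_comp]
    have : h.pageMap h3 h4 ∘ₗ h.pageMap h1 h2 = 0 := by
      ext x
      exact pageClass_eq_zero_iff.2 (by
        have : d (d (x : M)) = 0 := h.d_d _
        simp [cyclesMap, this])
    rw [this]
    rfl

theorem page_d {r : ℤ} {a b : ℤ × ℤ} (h1 : a.1 + 1 = b.1) (h2 : a.2 + r * n = b.2) :
    (h.page n r).d a b = ModuleCat.ofHom (h.pageMap h1 h2) := dif_pos ⟨h1, h2⟩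

end IsFilteredComplex

namespace HomologicalComplex

variable {ι : Type*} {c : ComplexShape ι} (K : HomologicalComplex (ModuleCat.{v} k) c)

theorem iCycles_injective (b : ι) : Function.Injective (K.iCycles b).hom :=
  (ModuleCat.mono_iff_injective _).1 inferInstance

theorem homologyπ_surjective (b : ι) : Function.Surjective (K.homologyπ b).hom :=
  (ModuleCat.epi_iff_surjective _).1 inferInstance

theorem d_iCycles_apply {a b : ι} (z : (K.cycles a : ModuleCat k)) :
    (K.d a b).hom ((K.iCycles a).hom z) = 0 := by
  rw [← LinearMap.comp_apply, ← ModuleCat.hom_comp, K.iCycles_d]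
  rfl

theorem homologyπ_eq_zero_iff {a b : ι} (hab : c.Rel a b) (z : (K.cycles b : ModuleCat k)) :
    (K.homologyπ b).hom z = 0 ↔ ∃ y : K.X a, (K.d a b).hom y = (K.iCycles b).hom z := by
  have hprev := c.prev_eq' hab
  have hex : (ShortComplex.mk (K.toCycles a b) (K.homologyπ b) (K.toCycles_comp_homologyπ a b)).Exact :=
    ShortComplex.exact_of_g_is_cokernel _ (K.homologyIsCokernel a b hprev)
  rw [ShortComplex.moduleCat_exact_iff] at hex
  constructor
  · intro hz
    obtain ⟨y, hy⟩ := hex z hz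
    refine ⟨y, ?_⟩
    rw [← K.toCycles_i a b, ModuleCat.hom_comp, LinearMap.comp_apply]
    exact congrArg _ hy
  · rintro ⟨y, hy⟩
    have : (K.toCycles a b).hom y = z := by
      apply K.iCycles_injective
      rw [← hy, ← K.toCycles_i a b, ModuleCat.hom_comp, LinearMap.comp_apply]
    rw [← this, ← LinearMap.comp_apply, ← ModuleCat.hom_comp, K.toCycles_comp_homologyπ]
    rfl

end HomologicalComplex

namespace IsResidueSplit

variable (h : IsResidueSplit d C F n π)

include h in
theorem proj_mem_pageCycles {r i j : ℤ} {x : M} (hx : x ∈ pageCycles d C F n r i j) :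
    π j x ∈ pageCycles d C F n r i j := by
  rw [mem_pageCycles] at hx ⊢
  refine ⟨h.proj_mem_C j hx.1, h.proj_mem_F j hx.2.1, ?_⟩
  rw [← h.proj_d]
  exact h.proj_mem_F j hx.2.2

include h in
theorem pageCycles_succ_le (r i j : ℤ) :
    pageCycles d C F n (r + 1) i j ≤ pageCycles d C F n r i j := by
  intro x hx
  rw [mem_pageCycles] at hx ⊢
  exact ⟨hx.1, hx.2.1, h.antitone (by nlinarith) hx.2.2⟩

include h in
/-- If `d_r` vanishes on a class of `E_r`, then the class is represented by an element of
`Z_{r+1}`. -/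
theorem exists_mem_pageCycles_succ {r i j : ℤ} {x : M} (hx : x ∈ pageCycles d C F n r i j)
    (hdx : d x ∈ pageBoundaries d C F n r (i + 1) (j + r * n)) :
    ∃ y ∈ pageCycles d C F n (r + 1) i j, x - y ∈ pageBoundaries d C F n r i j := by
  obtain ⟨u, ⟨hu, hu'⟩, w, ⟨hwC, hwF⟩, hdw, he⟩ := mem_pageBoundaries.1 hdx
  have hπx := mem_pageCycles.1 (h.proj_mem_pageCycles hx)
  rw [add_sub_cancel_right] at hwC hwF
  have hwπ := h.proj_mem_F j hwF
  have hxC := (mem_pageCycles.1 hx)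
  -- the correction by `w` leaves `u`, of which the projection drops the part in filtration degrees
  -- strictly between `j + r * n` and `j + (r + 1) * n`
  refine ⟨π j x - π j w, ?_, ?_⟩
  · refine mem_pageCycles.2 ⟨sub_mem hπx.1 (h.proj_mem_C j hwC),
      sub_mem hπx.2.1 (h.antitone (by lia) hwπ), ?_⟩
    have : d (π j x - π j w) = π j u := by
      rw [map_sub, ← h.proj_d, ← h.proj_d, ← he, map_add, add_sub_cancel_right]
    rw [this]
    exact h.proj_mem_F_add r hu'
  · refine mem_pageBoundaries.2 ⟨x - π j x + π j w, ⟨mem_pageCycles.2 ⟨?_, ?_, ?_⟩, ?_⟩, 0,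
      ⟨zero_mem _, zero_mem _⟩, by simp, by simp; abel⟩
    · exact add_mem (sub_mem hxC.1 hπx.1) (h.proj_mem_C j hwC)
    · exact add_mem (sub_mem hxC.2.1 hπx.2.1) (h.antitone (by lia) hwπ)
    · rw [map_add, map_sub, ← h.proj_d j w]
      exact add_mem (sub_mem hxC.2.2 hπx.2.2) (h.proj_mem_F j hdw)
    · exact add_mem (h.sub_proj_mem hxC.2.1) hwπ

include h in
/-- An element of `Z_{r+1}` gives zero in `E_{r+1}` if and only if its class in `E_r` is
in the image of `d_r`. -/
theorem mem_pageBoundaries_succ_iff {r i j : ℤ} {z : M}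
    (hz : z ∈ pageCycles d C F n (r + 1) i j) :
    z ∈ pageBoundaries d C F n (r + 1) i j ↔
      ∃ y ∈ pageCycles d C F n r (i - 1) (j - r * n), z - d y ∈ pageBoundaries d C F n r i j := by
  have hz' := mem_pageCycles.1 hz
  constructor
  · intro hb
    -- the boundary `d v` is that of `π j v`, which lies in `Z_r`, up to filtration `≥ j + 1`
    obtain ⟨b, ⟨hbZ, hb'⟩, v, ⟨hvC, hvF⟩, hdv, rfl⟩ := mem_pageBoundaries.1 hb
    have hπv : π j v ∈ F (j - r * n) := by
      have := h.proj_mem_F_add (j := j) (x := v) (-(r + 1)) (h.antitone (by lia) hvF)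
      exact h.antitone (by lia) this
    refine ⟨π j v, mem_pageCycles.2 ⟨h.proj_mem_C j hvC, hπv, ?_⟩, ?_⟩
    · rw [← h.proj_d]
      exact h.antitone (by lia) (h.proj_mem_F j hdv)
    · have hd : d v - π j (d v) ∈ F (j + 1) := h.sub_proj_mem hdv
      have hC : d v ∈ C i := by simpa using h.d_mem_C hvC
      refine mem_pageBoundaries.2 ⟨b + (d v - π j (d v)),
        ⟨add_mem (h.pageCycles_succ_le _ _ _ hbZ) (mem_pageCycles.2 ⟨?_, ?_, ?_⟩),
          add_mem hb' hd⟩, 0, ⟨zero_mem _, zero_mem _⟩, by simp, by simp [h.proj_d]; abel⟩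
      · exact sub_mem hC (h.proj_mem_C j hC)
      · exact h.antitone (by lia) hd
      · rw [map_sub, ← h.proj_d, h.d_d]
        simp
  · rintro ⟨y, hy, hb⟩
    rw [mem_pageCycles] at hy
    obtain ⟨b, ⟨hb, hb'⟩, w, ⟨hwC, hwF⟩, hdw, he⟩ := mem_pageBoundaries.1 hb
    rw [mem_pageCycles] at hb
    have hdy : d y ∈ F j := h.antitone (by lia) hy.2.2
    have hbe : b = z - d (y + w) := by rw [map_add, ← sub_sub, ← he]; abel
    refine mem_pageBoundaries.2 ⟨b, ⟨mem_pageCycles.2 ⟨hb.1, hb.2.1, ?_⟩, hb'⟩, y + w,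
      ⟨add_mem hy.1 hwC, add_mem (h.antitone ?_ hy.2.1) (h.antitone ?_ hwF)⟩, ?_, ?_⟩
    · rw [hbe, map_sub, h.d_d, sub_zero]
      exact hz'.2.2
    · have : (0 : ℤ) < n := by exact_mod_cast h.pos
      nlinarith
    · nlinarith
    · rw [map_add]
      exact add_mem hdy hdw
    · rw [hbe]; abel

/-- The map from `Z_{r+1}` to the page `E_r`. -/
noncomputable def toPage (r : ℤ) (a : ℤ × ℤ) :
    ModuleCat.of k ↥(pageCycles d C F n (r + 1) a.1 a.2) ⟶
      (h.toIsFilteredComplex.page n r).X a :=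
  ModuleCat.ofHom (Submodule.mkQ _ ∘ₗ Submodule.inclusion (h.pageCycles_succ_le r a.1 a.2))

/-- The map from `Z_{r+1}` to the cycles of the page `E_r`. -/
noncomputable def toCycles (r : ℤ) (a : ℤ × ℤ) :
    ModuleCat.of k ↥(pageCycles d C F n (r + 1) a.1 a.2) ⟶
      (h.toIsFilteredComplex.page n r).cycles a :=
  HomologicalComplex.liftCycles _ (h.toPage r a) (a.1 + 1, a.2 + r * n)
    (ComplexShape.next_eq' _ rfl) (by
      rw [h.page_d rfl rfl]
      ext x
      refine IsFilteredComplex.pageClass_eq_zero_iff.2 (mem_pageBoundaries.2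
        ⟨d x, ⟨?_, ?_⟩, 0, ⟨zero_mem _, zero_mem _⟩, by simp, by simp; rfl⟩)
      · exact h.d_mem_pageCycles rfl rfl (h.pageCycles_succ_le _ _ _ x.2)
      · have : (0 : ℤ) < n := by exact_mod_cast h.pos
        exact h.antitone (by nlinarith) (mem_pageCycles.1 x.2).2.2)

theorem iCycles_toCycles (r : ℤ) (a : ℤ × ℤ) (x : ↥(pageCycles d C F n (r + 1) a.1 a.2)) :
    ((h.toIsFilteredComplex.page n r).iCycles a).hom ((h.toCycles r a).hom x) =
      pageClass d C F n (Submodule.inclusion (h.pageCycles_succ_le r a.1 a.2) x) := by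
  rw [← LinearMap.comp_apply, ← ModuleCat.hom_comp, toCycles, HomologicalComplex.liftCycles_i]
  rfl

theorem homologyπ_toCycles_eq_zero_iff (r : ℤ) (a : ℤ × ℤ)
    (x : ↥(pageCycles d C F n (r + 1) a.1 a.2)) :
    ((h.toIsFilteredComplex.page n r).homologyπ a).hom ((h.toCycles r a).hom x) = 0 ↔
      (x : M) ∈ pageBoundaries d C F n (r + 1) a.1 a.2 := by
  have hrel : (colorShape n r).Rel (a.1 - 1, a.2 - r * n) a := by
    ext <;> simp
  rw [HomologicalComplex.homologyπ_eq_zero_iff _ hrel, h.mem_pageBoundaries_succ_iff x.2,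
    h.page_d (by simp) (by simp)]
  rw [iCycles_toCycles]
  constructor
  · rintro ⟨y, hy⟩
    obtain ⟨y, rfl⟩ := IsFilteredComplex.pageClass_surjective y
    refine ⟨y, y.2, ?_⟩
    exact IsFilteredComplex.pageClass_eq_iff.1 hy.symm
  · rintro ⟨y, hy, hb⟩
    exact ⟨pageClass d C F n ⟨y, hy⟩, (IsFilteredComplex.pageClass_eq_iff.2 hb).symm⟩

theorem exists_homologyπ_toCycles (r : ℤ) (a : ℤ × ℤ)
    (c : ((h.toIsFilteredComplex.page n r).cycles a : ModuleCat k)) :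
    ∃ x, ((h.toIsFilteredComplex.page n r).iCycles a).hom c =
      ((h.toIsFilteredComplex.page n r).iCycles a).hom ((h.toCycles r a).hom x) := by
  obtain ⟨x, hx⟩ := IsFilteredComplex.pageClass_surjective
    (((h.toIsFilteredComplex.page n r).iCycles a).hom c)
  have h0 := HomologicalComplex.d_iCycles_apply _ (b := (a.1 + 1, a.2 + r * n)) c
  rw [← hx, h.page_d rfl rfl] at h0
  obtain ⟨y, hy, hxy⟩ := h.exists_mem_pageCycles_succ x.2
    (IsFilteredComplex.pageClass_eq_zero_iff.1 h0)
  refine ⟨⟨y, hy⟩, ?_⟩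
  rw [iCycles_toCycles, ← hx]
  exact IsFilteredComplex.pageClass_eq_iff.2 hxy

/-- The identification of the homology of a page with the next page. -/
noncomputable def pageIso (r : ℤ) (a : ℤ × ℤ) :
    (h.toIsFilteredComplex.page n r).homology a ≅ (h.toIsFilteredComplex.page n (r + 1)).X a :=
  (((Submodule.quotEquivOfEq _ _ (by
      ext x
      exact (h.homologyπ_toCycles_eq_zero_iff r a x).symm)).trans
    (LinearMap.quotKerEquivOfSurjective
      ((h.toCycles r a ≫ (h.toIsFilteredComplex.page n r).homologyπ a).hom) (by
        intro c
        obtain ⟨c, rfl⟩ := HomologicalComplex.homologyπ_surjective _ _ c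
        obtain ⟨x, hx⟩ := h.exists_homologyπ_toCycles r a c
        refine ⟨x, ?_⟩
        rw [HomologicalComplex.iCycles_injective _ _ hx]
        rfl))).symm).toModuleIso

theorem pageIso_homologyπ_toCycles (r : ℤ) (a : ℤ × ℤ)
    (x : ↥(pageCycles d C F n (r + 1) a.1 a.2)) :
    (h.pageIso r a).hom.hom (((h.toIsFilteredComplex.page n r).homologyπ a).hom
      ((h.toCycles r a).hom x)) = pageClass d C F n x := by
  refine (LinearEquiv.symm_apply_eq _).2 ?_
  rfl

/-- The spectral sequence of a filtered complex. -/
noncomputable def spectralSequence : SpectralSequence (ModuleCat.{v} k) (colorShape n) 0 where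
  page r _ := h.toIsFilteredComplex.page n r
  iso r r' a hrr' _ := h.pageIso r a ≪≫ eqToIso (by rw [hrr'])

theorem isSpectralSequenceOfFiltered : IsSpectralSequenceOfFiltered d C F n h.spectralSequence := by
  refine ⟨fun r _ i j => LinearEquiv.refl _ _, ?_, ?_⟩
  · intro r hr i j x y hxy
    change ((h.toIsFilteredComplex.page n r).d (i, j) (i + 1, j + r * n)).hom
      (pageClass d C F n x) = _
    rw [h.page_d rfl rfl]
    refine congrArg (pageClass d C F n) (Subtype.ext hxy.symm)
  · intro r hr hr' i j c x x' hx hc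
    have : c = (h.toCycles r (i, j)).hom x' := by
      apply HomologicalComplex.iCycles_injective
      refine hc.trans ?_
      refine Eq.trans ?_ (h.iCycles_toCycles r (i, j) x').symm
      exact congrArg (pageClass d C F n) (Subtype.ext hx.symm)
    subst this
    refine Eq.trans ?_ (h.pageIso_homologyπ_toCycles r (i, j) x')
    simp [spectralSequence]
    rfl

end IsResidueSplit
end FilteredComplex

/-! ### Convergence of the spectral sequence -/

section SubQuot

variable {k : Type u} [CommRing k] {M : Type v} [AddCommGroup M] [Module k M]
  {N : Type*} [AddCommGroup N] [Module k N]

/-- A surjection with source `Z` and kernel `Z ∩ B` identifies `Z / (Z ∩ B)` with its target. -/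
noncomputable def SubQuot.equivOfSurjective {Z B : Submodule k M} (f : ↥Z →ₗ[k] N)
    (hf : Function.Surjective f) (hker : ∀ z, f z = 0 ↔ (z : M) ∈ B) : SubQuot Z B ≃ₗ[k] N :=
  (Submodule.quotEquivOfEq _ _ (by
    ext z
    exact (hker z).symm)).trans (LinearMap.quotKerEquivOfSurjective f hf)

open Classical in
/-- Over a field, a module with a finite filtration is isomorphic to the associated
graded module. -/
theorem nonempty_directSum_subQuot_equiv (hk : IsField k) {G : ℤ → Submodule k M}
    (hG : Antitone G) (b : ℕ) (htop : ∀ j : ℤ, j ≤ -b → G j = ⊤) (hbot : ∀ j : ℤ, b < j → G j = ⊥) :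
    Nonempty ((DirectSum ℤ fun j => SubQuot (G j) (G (j + 1))) ≃ₗ[k] M) := by
  have hsec : ∀ j, ∃ σ : SubQuot (G j) (G (j + 1)) →ₗ[k] ↥(G j),
      (Submodule.mkQ ((G (j + 1)).submoduleOf (G j))) ∘ₗ σ = LinearMap.id := by
    intro j
    let := hk.toField
    exact LinearMap.exists_rightInverse_of_surjective _ (Submodule.range_mkQ _)
  choose σ hσ using hsec
  have hσ' : ∀ j (x : ↥(G j)), (x : M) - σ j (Submodule.Quotient.mk x) ∈ G (j + 1) := by
    intro j x
    have := LinearMap.congr_fun (hσ j) (Submodule.Quotient.mk x)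
    exact (Submodule.Quotient.eq (Submodule.submoduleOf (G (j + 1)) (G j))).1 this.symm
  let T : (DirectSum ℤ fun j => SubQuot (G j) (G (j + 1))) →ₗ[k] M :=
    DirectSum.toModule k ℤ M fun j => (G j).subtype ∘ₗ σ j
  have hT : ∀ j x, T (DirectSum.lof k ℤ _ j x) = σ j x := fun j x => by
    rw [show T = DirectSum.toModule k ℤ M fun j => (G j).subtype ∘ₗ σ j from rfl,
      DirectSum.toModule_lof]
    rfl
  have hTsum : ∀ y, T y = ∑ i ∈ DFinsupp.support y, (σ i (y i) : M) := by
    intro y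
    conv_lhs => rw [← DirectSum.sum_support_of y]
    rw [map_sum]
    exact Finset.sum_congr rfl fun i _ => hT i (y i)
  refine ⟨LinearEquiv.ofBijective T ⟨?_, ?_⟩⟩
  · rw [injective_iff_map_eq_zero]
    intro y hy
    -- if the components below `j` vanish, then `T y` determines `y j` modulo `G (j + 1)`
    have step : ∀ j, (∀ i < j, y i = 0) → y j = 0 := by
      intro j hj
      have h1 : (σ j (y j) : M) ∈ G (j + 1) := by
        have h2 : T y - σ j (y j) ∈ G (j + 1) := by
          rw [hTsum]
          by_cases hmem : j ∈ DFinsupp.support y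
          · rw [← Finset.sum_erase_add _ _ hmem, add_sub_cancel_right]
            refine Submodule.sum_mem _ fun i hi => ?_
            rcases lt_trichotomy i j with h | h | h
            · rw [hj i h, map_zero]
              exact zero_mem _
            · exact absurd h (Finset.ne_of_mem_erase hi)
            · exact hG h (σ i (y i)).2
          · have h0 : y j = 0 := by simpa using hmem
            rw [h0, map_zero, Submodule.coe_zero, sub_zero]
            refine Submodule.sum_mem _ fun i hi => ?_
            rcases lt_trichotomy i j with h | h | h
            · rw [hj i h, map_zero]
              exact zero_mem _
            · exact absurd hi (h ▸ hmem)
            · exact hG h (σ i (y i)).2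
        rw [hy, zero_sub] at h2
        exact neg_mem_iff.1 h2
      have h3 := LinearMap.congr_fun (hσ j) (y j)
      rw [LinearMap.id_apply] at h3
      rw [← h3]
      exact (Submodule.Quotient.mk_eq_zero _).2 h1
    have hlow : ∀ j : ℤ, j < -b → y j = 0 := by
      intro j hj
      obtain ⟨x, hx⟩ := Submodule.Quotient.mk_surjective _ (y j)
      rw [← hx]
      refine (Submodule.Quotient.mk_eq_zero _).2 ?_
      change (x : M) ∈ G (j + 1)
      rw [htop (j + 1) (by lia)]
      trivial
    have hall : ∀ m : ℕ, ∀ j : ℤ, j < -b + m → y j = 0 := by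
      intro m
      induction m with
      | zero => simpa using hlow
      | succ m ih =>
        intro j hj
        exact step j fun i hi => ih i (by push_cast at hj; lia)
    refine DFinsupp.ext fun j => ?_
    exact hall (j + b + 1).toNat j (by lia)
  · have hall : ∀ m : ℕ, ∀ x ∈ G (b + 1 - m), x ∈ LinearMap.range T := by
      intro m
      induction m with
      | zero =>
        intro x hx
        rw [hbot _ (by simp), Submodule.mem_bot] at hx
        rw [hx]
        exact zero_mem _
      | succ m ih =>
        intro x hx
        have h1 := hσ' _ ⟨x, hx⟩
        have h2 := ih _ (hG (by push_cast; lia) h1)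
        rw [← sub_add_cancel x]
        exact add_mem h2 ⟨_, hT _ _⟩
    intro x
    exact hall (2 * b + 1) x (by rw [htop _ (by push_cast; lia)]; trivial)

end SubQuot

namespace IsFilteredComplex

variable {k : Type u} [CommRing k] {M : Type v} [AddCommGroup M] [Module k M]
  {d : M →ₗ[k] M} {C F : ℤ → Submodule k M} {n : ℕ} (h : IsFilteredComplex d C F) {b : ℕ}
  (htop : ∀ j : ℤ, j ≤ -b → F j = ⊤) (hbot : ∀ j : ℤ, b < j → F j = ⊥)

theorem mem_pageCycles_of_mem_ker {r i j : ℤ} {x : M} (hx : x ∈ LinearMap.ker d ⊓ C i)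
    (hj : x ∈ F j) : x ∈ pageCycles d C F n r i j := by
  rw [mem_pageCycles, LinearMap.mem_ker.1 hx.1]
  exact ⟨hx.2, hj, zero_mem _⟩

theorem pageClass_eq_zero_of_mem_succ {r i j : ℤ} {x : ↥(pageCycles d C F n r i j)}
    (hx : (x : M) ∈ F (j + 1)) : pageClass d C F n x = 0 :=
  pageClass_eq_zero_iff.2 (mem_pageBoundaries.2
    ⟨x, ⟨x.2, hx⟩, 0, ⟨zero_mem _, zero_mem _⟩, by simp, by simp⟩)

/-- The filtration on the homology of a filtered complex. -/
def homologyFilt (d : M →ₗ[k] M) (C F : ℤ → Submodule k M) (i j : ℤ) :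
    Submodule k (SubQuot (LinearMap.ker d ⊓ C i) ((C (i - 1)).map d)) :=
  ((F j).submoduleOf (LinearMap.ker d ⊓ C i)).map (Submodule.mkQ _)

/-- The map from the cycles in `F j` to the page `E_r`. -/
def cyclesToPage (d : M →ₗ[k] M) (C F : ℤ → Submodule k M) (n : ℕ) (r i j : ℤ) :
    ↥((F j).submoduleOf (LinearMap.ker d ⊓ C i)) →ₗ[k] FilteredPage d C F n r i j :=
  Submodule.mkQ _ ∘ₗ LinearMap.codRestrict _
    ((LinearMap.ker d ⊓ C i).subtype ∘ₗ Submodule.subtype _)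
    fun x => mem_pageCycles_of_mem_ker x.1.2 x.2

/-- The map from the cycles in `F j` to the `j`-th graded piece of the homology. -/
def cyclesToGraded (d : M →ₗ[k] M) (C F : ℤ → Submodule k M) (i j : ℤ) :
    ↥((F j).submoduleOf (LinearMap.ker d ⊓ C i)) →ₗ[k]
      SubQuot (homologyFilt d C F i j) (homologyFilt d C F i (j + 1)) :=
  Submodule.mkQ _ ∘ₗ LinearMap.restrict (Submodule.mkQ _)
    fun _ hx => Submodule.mem_map_of_mem hx

theorem cyclesToGraded_surjective (i j : ℤ) : Function.Surjective (cyclesToGraded d C F i j) := by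
  intro c
  obtain ⟨⟨_, x, hx, rfl⟩, rfl⟩ := Submodule.Quotient.mk_surjective _ c
  exact ⟨⟨x, hx⟩, rfl⟩

theorem cyclesToGraded_eq_zero_iff {i j : ℤ}
    (x : ↥((F j).submoduleOf (LinearMap.ker d ⊓ C i))) :
    cyclesToGraded d C F i j x = 0 ↔
      ∃ y ∈ LinearMap.ker d ⊓ C i, y ∈ F (j + 1) ∧ ∃ w ∈ C (i - 1), y + d w = x := by
  refine (Submodule.Quotient.mk_eq_zero _).trans ?_
  constructor
  · rintro ⟨y, hy, hyx⟩
    obtain ⟨w, hw, hwx⟩ := (Submodule.Quotient.eq _).1 hyx.symm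
    refine ⟨y, y.2, hy, w, hw, ?_⟩
    have : d w = (x : M) - y := hwx
    rw [this]
    abel
  · rintro ⟨y, hy, hyF, w, hw, hyx⟩
    refine ⟨⟨y, hy⟩, hyF, ((Submodule.Quotient.eq _).2 ?_).symm⟩
    refine ⟨w, hw, ?_⟩
    change d w = (x : M) - y
    rw [← hyx]
    abel

include htop hbot

theorem cyclesToPage_surjective {r i j : ℤ} (hr : 2 * b + 1 ≤ r * n) :
    Function.Surjective (cyclesToPage d C F n r i j) := by
  intro c
  obtain ⟨x, rfl⟩ := pageClass_surjective c
  have hx := mem_pageCycles.1 x.2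
  by_cases hj : (b : ℤ) < j + r * n
  · have h0 := hx.2.2
    rw [hbot _ hj, Submodule.mem_bot] at h0
    exact ⟨⟨⟨x, h0, hx.1⟩, hx.2.1⟩, rfl⟩
  · refine ⟨0, ?_⟩
    rw [map_zero]
    exact (pageClass_eq_zero_of_mem_succ (by rw [htop _ (by lia)]; trivial)).symm

include h in
theorem cyclesToPage_eq_zero_iff {r i j : ℤ} (hr : 2 * b + 1 ≤ r * n)
    (x : ↥((F j).submoduleOf (LinearMap.ker d ⊓ C i))) :
    cyclesToPage d C F n r i j x = 0 ↔
      ∃ y ∈ LinearMap.ker d ⊓ C i, y ∈ F (j + 1) ∧ ∃ w ∈ C (i - 1), y + d w = x := by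
  refine pageClass_eq_zero_iff.trans ?_
  change (x : M) ∈ _ ↔ _
  constructor
  · intro hx
    by_cases hj : (b : ℤ) < j + r * n
    · obtain ⟨y, ⟨hy, hy'⟩, w, hw, hdw, hx⟩ := mem_pageBoundaries.1 hx
      have hy0 := mem_pageCycles.1 hy
      rw [hbot _ hj] at hy0
      exact ⟨y, ⟨hy0.2.2, hy0.1⟩, hy', w, hw.1, hx⟩
    · exact ⟨x, x.1.2, by rw [htop _ (by lia)]; trivial, 0, zero_mem _, by simp⟩
  · rintro ⟨y, hy, hyF, w, hw, hyx⟩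
    by_cases hj : j ≤ b
    · refine mem_pageBoundaries.2 ⟨y, ⟨mem_pageCycles_of_mem_ker hy (h.antitone (by lia) hyF), hyF⟩,
        w, ⟨hw, by rw [htop _ (by lia)]; trivial⟩, ?_, hyx⟩
      rw [← sub_eq_of_eq_add' hyx.symm]
      exact sub_mem x.2 (h.antitone (by lia) hyF)
    · have hx : (x : M) ∈ F j := x.2
      have h0 : (x : M) = 0 := (Submodule.mem_bot k).1 (hbot j (by lia) ▸ hx)
      rw [h0]
      exact zero_mem _

include h in
/-- The stable page is the graded module associated with the filtration of the homology: both are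
quotients of the cycles in `F j` by the same submodule. -/
theorem nonempty_page_equiv_graded {r i j : ℤ} (hr : 2 * b + 1 ≤ r * n) :
    Nonempty (FilteredPage d C F n r i j ≃ₗ[k]
      SubQuot (homologyFilt d C F i j) (homologyFilt d C F i (j + 1))) := by
  have hker : LinearMap.ker (cyclesToPage d C F n r i j) =
      LinearMap.ker (cyclesToGraded d C F i j) := by
    ext x
    rw [LinearMap.mem_ker, LinearMap.mem_ker, cyclesToGraded_eq_zero_iff,
      h.cyclesToPage_eq_zero_iff htop hbot hr]
  exact ⟨(LinearMap.quotKerEquivOfSurjective _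
      (cyclesToPage_surjective htop hbot hr)).symm.trans
    ((Submodule.quotEquivOfEq _ _ hker).trans
      (LinearMap.quotKerEquivOfSurjective _ (cyclesToGraded_surjective i j)))⟩

theorem pageMap_eq_zero {r i j i' j' : ℤ} (hi : i + 1 = i') (hj : j + r * n = j')
    (hr : 2 * b + 1 ≤ r * n) : h.pageMap (r := r) (n := n) hi hj = 0 := by
  subst hi hj
  refine LinearMap.ext fun c => ?_
  obtain ⟨x, rfl⟩ := pageClass_surjective c
  have hx := mem_pageCycles.1 x.2
  by_cases hj : (b : ℤ) < j + r * n
  · refine pageClass_eq_zero_iff.2 ?_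
    have h0 : d x = 0 := by
      have := hx.2.2
      rwa [hbot _ hj, Submodule.mem_bot] at this
    have : ((h.cyclesMap rfl rfl x : ↥(pageCycles d C F n r (i + 1) (j + r * n))) : M) = 0 := h0
    rw [this]
    exact zero_mem _
  · have : pageClass d C F n x = 0 :=
      pageClass_eq_zero_of_mem_succ (by rw [htop _ (by lia)]; trivial)
    rw [this, map_zero, LinearMap.zero_apply]

include h in
/-- Over a field, the direct sum of the stable page is the homology. -/
theorem nonempty_directSum_page_equiv (hk : IsField k) {r i : ℤ} (hr : 2 * b + 1 ≤ r * n) :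
    Nonempty ((DirectSum ℤ fun j => FilteredPage d C F n r i j) ≃ₗ[k]
      SubQuot (LinearMap.ker d ⊓ C i) ((C (i - 1)).map d)) := by
  have hG : Antitone (homologyFilt d C F i) := fun j j' hj =>
    Submodule.map_mono (Submodule.comap_mono (h.antitone hj))
  obtain ⟨φ⟩ := nonempty_directSum_subQuot_equiv hk hG b
    (fun j hj => by
      rw [eq_top_iff]
      intro c _
      obtain ⟨x, rfl⟩ := Submodule.Quotient.mk_surjective _ c
      refine ⟨x, ?_, rfl⟩
      change (x : M) ∈ F j
      rw [htop j hj]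
      trivial)
    (fun j hj => by
      rw [eq_bot_iff]
      rintro _ ⟨x, hx, rfl⟩
      have h0 : (x : M) ∈ F j := hx
      rw [hbot j hj, Submodule.mem_bot] at h0
      obtain rfl : x = 0 := Subtype.ext h0
      simp)
  let ψ : ∀ j, FilteredPage d C F n r i j ≃ₗ[k]
      SubQuot (homologyFilt d C F i j) (homologyFilt d C F i (j + 1)) :=
    fun j => (h.nonempty_page_equiv_graded htop hbot hr).some
  exact ⟨(DFinsupp.mapRange.linearEquiv ψ).trans φ⟩

end IsFilteredComplex

namespace PerfectMatchingGraph

variable {V : Type w} {E : Type v} (Γ : PerfectMatchingGraph V E)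

/-! ### Circles of adjacent states -/

section Circles

variable {Γ} {α β : Γ.State} {e : Γ.MEdge}

theorem circleOf_surjective (c : Γ.Circle α) : ∃ x, Γ.circleOf α x = c := Quot.exists_rep c

theorem circleOf_eq_of_glued {x y : Γ.Arc} (h : Γ.Glued α x y) :
    Γ.circleOf α x = Γ.circleOf α y := Quot.sound h

/-- The circle passes along neither side of the matching edge `e`. -/
def Away (e : Γ.MEdge) (c : Γ.Circle α) : Prop :=
  c ≠ Γ.circleOf α (Γ.arcL e false) ∧ c ≠ Γ.circleOf α (Γ.arcR e false)

/-- Two arcs are glued by the smoothing of the single matching edge `f` in the state `α`. -/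
def GluedAt (α : Γ.State) (f : Γ.MEdge) (x y : Γ.Arc) : Prop :=
  (Γ.Parallel α f ∧ ((x = Γ.arcL f false ∧ y = Γ.arcR f true) ∨
      (x = Γ.arcR f false ∧ y = Γ.arcL f true))) ∨
    (¬ Γ.Parallel α f ∧ ((x = Γ.arcL f false ∧ y = Γ.arcL f true) ∨
      (x = Γ.arcR f false ∧ y = Γ.arcR f true)))

theorem gluedAt_congr {f : Γ.MEdge} (h : f ∈ α ↔ f ∈ β) {x y : Γ.Arc} :
    GluedAt α f x y ↔ GluedAt β f x y := by
  simp only [GluedAt, Parallel, h]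

theorem not_away_arc (α : Γ.State) (e : Γ.MEdge) (b : Bool) :
    ¬ Away e (Γ.circleOf α (Γ.arcL e b)) ∧ ¬ Away e (Γ.circleOf α (Γ.arcR e b)) := by
  cases b
  · simp [Away]
  · by_cases hp : Γ.Parallel α e
    · have h1 : Γ.circleOf α (Γ.arcL e false) = Γ.circleOf α (Γ.arcR e true) :=
        circleOf_eq_of_glued ⟨e, Or.inl ⟨hp, Or.inl ⟨rfl, rfl⟩⟩⟩
      have h2 : Γ.circleOf α (Γ.arcR e false) = Γ.circleOf α (Γ.arcL e true) :=
        circleOf_eq_of_glued ⟨e, Or.inl ⟨hp, Or.inr ⟨rfl, rfl⟩⟩⟩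
      simp [Away, h1, h2]
    · have h1 : Γ.circleOf α (Γ.arcL e false) = Γ.circleOf α (Γ.arcL e true) :=
        circleOf_eq_of_glued ⟨e, Or.inr ⟨hp, Or.inl ⟨rfl, rfl⟩⟩⟩
      have h2 : Γ.circleOf α (Γ.arcR e false) = Γ.circleOf α (Γ.arcR e true) :=
        circleOf_eq_of_glued ⟨e, Or.inr ⟨hp, Or.inr ⟨rfl, rfl⟩⟩⟩
      simp [Away, h1, h2]

theorem not_away_of_gluedAt {x y : Γ.Arc} (h : GluedAt α e x y) (β : Γ.State) :
    ¬ Away e (Γ.circleOf β x) ∧ ¬ Away e (Γ.circleOf β y) := by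
  rcases h with ⟨_, ⟨rfl, rfl⟩ | ⟨rfl, rfl⟩⟩ | ⟨_, ⟨rfl, rfl⟩ | ⟨rfl, rfl⟩⟩ <;>
    simp [not_away_arc]

/-- The states `α` and `β` differ at most at the matching edge `e`. -/
def AgreeOff (e : Γ.MEdge) (α β : Γ.State) : Prop := ∀ f, f ≠ e → (f ∈ α ↔ f ∈ β)

theorem AgreeOff.symm (h : AgreeOff e α β) : AgreeOff e β α := fun f hf => (h f hf).symm

/-- Arcs on circles away from `e` stay so when the smoothing at `e` is changed. -/
theorem AgreeOff.away_imp (h : AgreeOff e α β) {x : Γ.Arc} (hx : Away e (Γ.circleOf α x)) :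
    Away e (Γ.circleOf β x) := by
  -- not being away from `e` in `α` is a property of arcs that is invariant under gluing in `β`
  let P : Γ.Circle β → Prop := Quot.lift (fun x => Away e (Γ.circleOf α x)) (by
    rintro y z ⟨f, hf⟩
    by_cases hfe : f = e
    · subst hfe
      have := not_away_of_gluedAt hf α
      simp [this]
    · have : Γ.circleOf α y = Γ.circleOf α z :=
        circleOf_eq_of_glued ⟨f, (gluedAt_congr (h f hfe)).2 hf⟩
      simp [this])
  have hP : ∀ y, P (Γ.circleOf β y) ↔ Away e (Γ.circleOf α y) := fun y => Iff.rfl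
  constructor
  · intro hc
    rw [← hP, hc, hP] at hx
    exact (not_away_arc α e false).1 hx
  · intro hc
    rw [← hP, hc, hP] at hx
    exact (not_away_arc α e false).2 hx

theorem AgreeOff.away_iff (h : AgreeOff e α β) {x : Γ.Arc} :
    Away e (Γ.circleOf α x) ↔ Away e (Γ.circleOf β x) :=
  ⟨h.away_imp, h.symm.away_imp⟩

/-- The circles away from `e` consist of the same arcs in both states. -/
theorem AgreeOff.circleOf_eq (h : AgreeOff e α β) {x y : Γ.Arc}
    (hx : Away e (Γ.circleOf α x)) (hxy : Γ.circleOf α x = Γ.circleOf α y) :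
    Γ.circleOf β x = Γ.circleOf β y := by
  have := Quot.eqvGen_exact hxy
  induction this with
  | rel x y hg =>
    obtain ⟨f, hf⟩ := hg
    by_cases hfe : f = e
    · subst hfe
      exact absurd hx (not_away_of_gluedAt hf α).1
    · exact circleOf_eq_of_glued ⟨f, (gluedAt_congr (h f hfe)).1 hf⟩
  | refl x => rfl
  | symm x y _ ih => exact (ih (hxy ▸ hx) hxy.symm).symm
  | trans x y z h1 _ ih1 ih2 =>
    have h1' : Γ.circleOf α x = Γ.circleOf α y := Quot.eqvGen_sound h1
    exact (ih1 hx h1').trans (ih2 (h1' ▸ hx) (h1'.symm.trans hxy))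

/-- An arc on a circle. -/
noncomputable def Circle.arc (c : Γ.Circle α) : Γ.Arc := Quot.out c

theorem circleOf_arc (c : Γ.Circle α) : Γ.circleOf α c.arc = c := Quot.out_eq c

theorem AgreeOff.circleOf_arc_circleOf (h : AgreeOff e α β) {x : Γ.Arc}
    (hx : Away e (Γ.circleOf α x)) :
    Γ.circleOf α (Γ.circleOf β x).arc = Γ.circleOf α x :=
  h.symm.circleOf_eq (by rw [circleOf_arc]; exact h.away_imp hx) (circleOf_arc _)

end Circles

section Products

variable {Γ} {α β : Γ.State} {e : Γ.MEdge} [Finite E] {A : Type*} [CommMonoid A]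

open Classical in
@[to_additive]
theorem AgreeOff.prod_away_eq (h : AgreeOff e α β) {F : Γ.Circle α → A} {G : Γ.Circle β → A}
    (hFG : ∀ x, Away e (Γ.circleOf α x) → G (Γ.circleOf β x) = F (Γ.circleOf α x)) :
    ∏ c with Away e c, G c = ∏ c with Away e c, F c := by
  refine Finset.prod_nbij' (fun c => Γ.circleOf α c.arc) (fun c => Γ.circleOf β c.arc) ?_ ?_ ?_ ?_ ?_
  all_goals
    intro c hc
    obtain ⟨x, rfl⟩ := circleOf_surjective c
    simp only [Finset.mem_filter, Finset.mem_univ, true_and] at hc ⊢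
  · rwa [h.away_iff, circleOf_arc]
  · rwa [← h.away_iff, circleOf_arc]
  · rw [h.symm.circleOf_arc_circleOf, circleOf_arc]
    rwa [circleOf_arc]
  · rw [h.circleOf_arc_circleOf, circleOf_arc]
    rwa [circleOf_arc]
  · rw [← hFG, circleOf_arc]
    rwa [h.away_iff, circleOf_arc]

open Classical in
@[to_additive]
theorem prod_circle_eq (e : Γ.MEdge) (F : Γ.Circle α → A) :
    ∏ c, F c = (if Γ.circleOf α (Γ.arcL e false) = Γ.circleOf α (Γ.arcR e false) then
      F (Γ.circleOf α (Γ.arcL e false)) else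
      F (Γ.circleOf α (Γ.arcL e false)) * F (Γ.circleOf α (Γ.arcR e false))) *
        ∏ c with Away e c, F c := by
  rw [← Finset.prod_filter_mul_prod_filter_not Finset.univ (fun c => Away e c), mul_comm]
  congr 1
  have : (Finset.univ.filter fun c : Γ.Circle α => ¬ Away e c) =
      {Γ.circleOf α (Γ.arcL e false), Γ.circleOf α (Γ.arcR e false)} := by
    ext c
    simp [Away]
    tauto
  rw [this]
  split_ifs with hpq
  · rw [hpq, Finset.pair_eq_singleton, Finset.prod_singleton]
  · rw [Finset.prod_pair hpq]

end Products

/-! ### Parity -/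

section Parity

variable {Γ}

/-- The non-matching half-edge that follows a matching half-edge. -/
def next (h : Γ.MEdge × Bool) : {e // e ∉ Γ.matching} × Bool :=
  (⟨(Γ.rot (h.1.1, h.2)).1, Γ.rot_notMem h.1.2⟩, (Γ.rot (h.1.1, h.2)).2)

/-- The non-matching half-edge that precedes a matching half-edge. -/
def prev (h : Γ.MEdge × Bool) : {e // e ∉ Γ.matching} × Bool :=
  (⟨(Γ.rot (Γ.rot (h.1.1, h.2))).1, Γ.rot_rot_notMem h.1.2⟩, (Γ.rot (Γ.rot (h.1.1, h.2))).2)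

theorem arcL_eq (e : Γ.MEdge) (b : Bool) : Γ.arcL e b = Sum.inl (next (e, b)).1 := rfl

theorem arcR_eq (e : Γ.MEdge) (b : Bool) : Γ.arcR e b = Sum.inl (prev (e, b)).1 := rfl

/-- Each vertex has one matching half-edge and the two non-matching ones next to it. -/
theorem bijective_next_prev [Finite E] : Function.Bijective (Sum.elim (next (Γ := Γ)) prev) := by
  have hnext : ∀ h : Γ.MEdge × Bool, ((next h).1.1, (next h).2) = Γ.rot (h.1.1, h.2) := fun _ => rfl
  have hprev : ∀ h : Γ.MEdge × Bool, ((prev h).1.1, (prev h).2) = Γ.rot (Γ.rot (h.1.1, h.2)) :=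
    fun _ => rfl
  have hinj : ∀ {h h' : Γ.MEdge × Bool}, (h.1.1, h.2) = (h'.1.1, h'.2) → h = h' := by
    rintro ⟨⟨a, ha⟩, b⟩ ⟨⟨a', ha'⟩, b'⟩ hh
    simpa using hh
  have hne : ∀ h h' : Γ.MEdge × Bool, next h ≠ prev h' := by
    intro h h' heq
    have h1 : Γ.rot (h.1.1, h.2) = Γ.rot (Γ.rot (h'.1.1, h'.2)) := by
      rw [← hnext, ← hprev, heq]
    have h2 := Γ.rot.injective h1
    exact Γ.rot_notMem (h := (h'.1.1, h'.2)) h'.1.2 (by rw [← h2]; exact h.1.2)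
  constructor
  · rintro (h | h) (h' | h') heq
    · refine congrArg _ (hinj (Γ.rot.injective ?_))
      rw [← hnext, ← hnext]
      simp only [Sum.elim_inl] at heq
      rw [heq]
    · exact absurd heq (hne h h')
    · exact absurd heq.symm (hne h' h)
    · refine congrArg _ (hinj (Γ.rot.injective (Γ.rot.injective ?_)))
      rw [← hprev, ← hprev]
      simp only [Sum.elim_inr] at heq
      rw [heq]
  · rintro ⟨⟨a, ha⟩, b⟩
    obtain ⟨g, ⟨hg, hgm⟩, -⟩ := Γ.perfect (Γ.vert (a, b))
    have hsub : ({g, Γ.rot g, Γ.rot (Γ.rot g)} : Set (E × Bool)) ⊆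
        {h | Γ.vert h = Γ.vert (a, b)} := by
      rintro h (rfl | rfl | rfl)
      · exact hg
      · exact (Γ.vert_rot _).trans hg
      · exact (Γ.vert_rot _).trans ((Γ.vert_rot _).trans hg)
    have hcard : ({g, Γ.rot g, Γ.rot (Γ.rot g)} : Set (E × Bool)).ncard = 3 := by
      rw [Set.ncard_eq_three]
      exact ⟨_, _, _, Γ.rot_ne.symm, Γ.rot_rot_ne.symm, Γ.rot_ne.symm, rfl⟩
    have heq := Set.eq_of_subset_of_ncard_le hsub (by
      rw [hcard]
      exact (Γ.trivalent (Γ.vert (a, b))).le)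
    have hmem : (a, b) ∈ ({g, Γ.rot g, Γ.rot (Γ.rot g)} : Set (E × Bool)) := by
      rw [heq]; rfl
    obtain ⟨g1, g2⟩ := g
    rcases hmem with h | h | h
    · exact absurd (by rw [← h] at hgm; exact hgm) ha
    · exact ⟨Sum.inl (⟨g1, hgm⟩, g2), Prod.ext (Subtype.ext (congrArg Prod.fst h).symm)
        (congrArg Prod.snd h).symm⟩
    · exact ⟨Sum.inr (⟨g1, hgm⟩, g2), Prod.ext (Subtype.ext (congrArg Prod.fst h).symm)
        (congrArg Prod.snd h).symm⟩

/-- A set of arcs (given by its indicator function `φ`) that is closed under gluing away from `e`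
has an even number of ends at `e`: it has an even number of ends altogether, and the ends at the
other matching edges are glued in pairs. -/
theorem even_ends [Finite E] {α : Γ.State} {e : Γ.MEdge} (φ : Γ.Arc → ZMod 2)
    (hφ : ∀ f, f ≠ e → ∀ x y, GluedAt α f x y → φ x = φ y) :
    φ (Γ.arcL e false) + φ (Γ.arcR e false) + φ (Γ.arcL e true) + φ (Γ.arcR e true) = 0 := by
  classical
  have := Fintype.ofFinite E
  have h1 : ∑ h : {e // e ∉ Γ.matching} × Bool, φ (Sum.inl h.1) = 0 := by
    rw [Fintype.sum_prod_type]
    simp [← two_mul, show (2 : ZMod 2) = 0 from rfl]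
  rw [← bijective_next_prev.sum_comp, Fintype.sum_sum_type, Fintype.sum_prod_type,
    Fintype.sum_prod_type, ← Finset.sum_add_distrib, Finset.sum_eq_single e] at h1
  · simp only [Sum.elim_inl, Sum.elim_inr, ← arcL_eq, ← arcR_eq, Fintype.sum_bool] at h1
    rw [← h1]
    ring
  · intro f _ hf
    simp only [Sum.elim_inl, Sum.elim_inr, ← arcL_eq, ← arcR_eq, Fintype.sum_bool]
    have key := hφ f hf
    by_cases hp : Γ.Parallel α f
    · rw [key _ _ (Or.inl ⟨hp, Or.inl ⟨rfl, rfl⟩⟩), key _ _ (Or.inl ⟨hp, Or.inr ⟨rfl, rfl⟩⟩)]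
      ring_nf
      simp [show (2 : ZMod 2) = 0 from rfl]
    · rw [key _ _ (Or.inr ⟨hp, Or.inl ⟨rfl, rfl⟩⟩), key _ _ (Or.inr ⟨hp, Or.inr ⟨rfl, rfl⟩⟩)]
      ring_nf
      simp [show (2 : ZMod 2) = 0 from rfl]
  · simp

/-- The two sides of a matching edge lie on the same circle before or after the change
of its smoothing. -/
theorem AgreeOff.circleOf_eq_or [Finite E] {α β : Γ.State} {e : Γ.MEdge} (h : AgreeOff e α β)
    (hα : Γ.Parallel α e) (hβ : ¬ Γ.Parallel β e) :
    Γ.circleOf α (Γ.arcL e false) = Γ.circleOf α (Γ.arcR e false) ∨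
      Γ.circleOf β (Γ.arcL e false) = Γ.circleOf β (Γ.arcR e false) := by
  classical
  let R : Γ.Arc → Γ.Arc → Prop := fun x y => ∃ f, f ≠ e ∧ GluedAt α f x y
  have hRα : ∀ x y, Relation.EqvGen R x y → Γ.circleOf α x = Γ.circleOf α y := fun x y hxy =>
    Quot.eqvGen_sound (hxy.mono fun x y ⟨f, _, hf⟩ => ⟨f, hf⟩)
  have hRβ : ∀ x y, Relation.EqvGen R x y → Γ.circleOf β x = Γ.circleOf β y := fun x y hxy =>
    Quot.eqvGen_sound (hxy.mono fun x y ⟨f, hfe, hf⟩ => ⟨f, (gluedAt_congr (h f hfe)).1 hf⟩)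
  have hpar := even_ends (α := α) (e := e)
    (fun x => if Relation.EqvGen R (Γ.arcL e false) x then 1 else 0) (by
      intro f hf x y hxy
      have hR : R x y := ⟨f, hf, hxy⟩
      have : Relation.EqvGen R (Γ.arcL e false) x ↔ Relation.EqvGen R (Γ.arcL e false) y :=
        ⟨fun h => h.trans _ _ _ (.rel _ _ hR), fun h => h.trans _ _ _ (.symm _ _ (.rel _ _ hR))⟩
      simp [this])
  simp only [Relation.EqvGen.refl, if_true] at hpar
  by_cases h1 : Relation.EqvGen R (Γ.arcL e false) (Γ.arcR e false)
  · exact Or.inl (hRα _ _ h1)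
  by_cases h2 : Relation.EqvGen R (Γ.arcL e false) (Γ.arcL e true)
  · refine Or.inl ((hRα _ _ h2).trans (Eq.symm ?_))
    exact circleOf_eq_of_glued ⟨e, Or.inl ⟨hα, Or.inr ⟨rfl, rfl⟩⟩⟩
  by_cases h3 : Relation.EqvGen R (Γ.arcL e false) (Γ.arcR e true)
  · refine Or.inr ((hRβ _ _ h3).trans (Eq.symm ?_))
    exact circleOf_eq_of_glued ⟨e, Or.inr ⟨hβ, Or.inr ⟨rfl, rfl⟩⟩⟩
  · simp [h1, h2, h3] at hpar

theorem agreeOff_insert [LinearOrder E] (α : Γ.State) (e : Γ.MEdge) : AgreeOff e α (insert e α) := by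
  intro f hf
  simp [hf]

/-- No edge of the hypercube goes from two circles at `e` to two circles at `e`. -/
theorem circleOf_eq_or_insert [Finite E] [LinearOrder E] {α : Γ.State} {e : Γ.MEdge} (he : e ∉ α) :
    Γ.circleOf α (Γ.arcL e false) = Γ.circleOf α (Γ.arcR e false) ∨
      Γ.circleOf (insert e α) (Γ.arcL e false) = Γ.circleOf (insert e α) (Γ.arcR e false) := by
  by_cases hp : Γ.Parallel α e
  · exact (agreeOff_insert α e).circleOf_eq_or hp (by simp_all [Parallel])
  · exact ((agreeOff_insert α e).symm.circleOf_eq_or (by simp_all [Parallel]) hp).symm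

end Parity

end PerfectMatchingGraph

namespace PerfectMatchingGraph

variable {V : Type w} {E : Type v} {Γ : PerfectMatchingGraph V E}

/-! ### The maps of the edges of the hypercube -/

section EdgeCoeff

variable {k : Type u} [CommRing k] {n : ℕ} {sqrtn : k}

/-- The exponents away from the matching edge `e` are the same. -/
def Unchanged {α β : Γ.State} (e : Γ.MEdge) (a : Γ.Circle α → Fin n) (b : Γ.Circle β → Fin n) :
    Prop :=
  ∀ x, Away e (Γ.circleOf α x) → b (Γ.circleOf β x) = a (Γ.circleOf α x)

open Classical in
theorem edgeCoeff_eq (t : ℕ) (e : Γ.MEdge) (s s' : Γ.EnhancedState n) :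
    Γ.edgeCoeff n sqrtn t e s s' =
      if Unchanged e s.exponent s'.exponent then
        if Γ.circleOf s.state (Γ.arcL e false) ≠ Γ.circleOf s.state (Γ.arcR e false) ∧
            Γ.circleOf s'.state (Γ.arcL e false) = Γ.circleOf s'.state (Γ.arcR e false) then
          if (s'.exponent (Γ.circleOf s'.state (Γ.arcL e false)) : ℕ) + t =
            s.exponent (Γ.circleOf s.state (Γ.arcL e false)) +
              s.exponent (Γ.circleOf s.state (Γ.arcR e false)) then 1 else 0
        else if Γ.circleOf s.state (Γ.arcL e false) = Γ.circleOf s.state (Γ.arcR e false) ∧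
            Γ.circleOf s'.state (Γ.arcL e false) ≠ Γ.circleOf s'.state (Γ.arcR e false) then
          if (s'.exponent (Γ.circleOf s'.state (Γ.arcL e false)) : ℕ) +
            s'.exponent (Γ.circleOf s'.state (Γ.arcR e false)) + t =
              s.exponent (Γ.circleOf s.state (Γ.arcL e false)) + 2 * (n / 2) then 1 else 0
        else if Γ.circleOf s.state (Γ.arcL e false) = Γ.circleOf s.state (Γ.arcR e false) ∧
            Γ.circleOf s'.state (Γ.arcL e false) = Γ.circleOf s'.state (Γ.arcR e false) then
          if (s'.exponent (Γ.circleOf s'.state (Γ.arcL e false)) : ℕ) + t =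
            s.exponent (Γ.circleOf s.state (Γ.arcL e false)) + n / 2 then sqrtn else 0
        else 0
      else 0 := by
  have : Unchanged e s.exponent s'.exponent ↔ ∀ x : Γ.Arc,
      Γ.circleOf s.state x ≠ Γ.circleOf s.state (Γ.arcL e false) →
      Γ.circleOf s.state x ≠ Γ.circleOf s.state (Γ.arcR e false) →
      s'.exponent (Γ.circleOf s'.state x) = s.exponent (Γ.circleOf s.state x) := by
    simp only [Unchanged, Away, and_imp]
  simp only [this]
  rfl

theorem edgeCoeff_map {l : Type*} [CommRing l] (f : k →+* l) (t : ℕ) (e : Γ.MEdge)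
    (s s' : Γ.EnhancedState n) :
    f (Γ.edgeCoeff n sqrtn t e s s') = Γ.edgeCoeff n (f sqrtn) t e s s' := by
  classical
  simp only [edgeCoeff_eq, apply_ite f, map_zero, map_one]

/-- The maps for `t` raise the quantum degree by `t`. -/
theorem qdeg_eq_of_edgeCoeff_ne_zero [Fintype E] [LinearOrder E] {t : ℕ} {e : Γ.MEdge}
    {s s' : Γ.EnhancedState n} (he : e ∉ s.state) (hs' : s'.state = insert e s.state)
    (h : Γ.edgeCoeff n sqrtn t e s s' ≠ 0) : s'.qdeg = s.qdeg + t := by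
  classical
  obtain ⟨α, a⟩ := s
  obtain ⟨β, b⟩ := s'
  simp only at hs' he
  subst hs'
  rw [edgeCoeff_eq] at h
  simp only at h
  split_ifs at h with h1 h2 h3 h4 h5 h6 h7
  all_goals first | exact absurd rfl h | skip
  all_goals
    have hsum := (agreeOff_insert α e).sum_away_eq
      (F := fun c => ((n / 2 : ℕ) : ℤ) - ((a c : ℕ) : ℤ))
      (G := fun c => ((n / 2 : ℕ) : ℤ) - ((b c : ℕ) : ℤ))
      (fun x hx => by rw [h1 x hx])
    simp only [EnhancedState.qdeg, Finset.card_insert_of_notMem he]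
    rw [sum_circle_eq e, sum_circle_eq e, hsum]
    push_cast
  · rw [if_pos h2.2, if_neg h2.1]
    zify at h3
    linarith
  · rw [if_neg h4.2, if_pos h4.1]
    zify at h5
    linarith
  · rw [if_pos h6.2, if_pos h6.1]
    zify at h7
    linarith

open Classical in
/-- The coefficients of the map for `∂̂`: exponents are added modulo `n`. -/
theorem edgeCoeff_add_edgeCoeff (hn : 0 < n) (e : Γ.MEdge) (s s' : Γ.EnhancedState n) :
    Γ.edgeCoeff n sqrtn 0 e s s' + Γ.edgeCoeff n sqrtn n e s s' =
      if Unchanged e s.exponent s'.exponent then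
        if Γ.circleOf s.state (Γ.arcL e false) ≠ Γ.circleOf s.state (Γ.arcR e false) ∧
            Γ.circleOf s'.state (Γ.arcL e false) = Γ.circleOf s'.state (Γ.arcR e false) then
          if s'.exponent (Γ.circleOf s'.state (Γ.arcL e false)) ≡
            s.exponent (Γ.circleOf s.state (Γ.arcL e false)) +
              s.exponent (Γ.circleOf s.state (Γ.arcR e false)) [MOD n] then 1 else 0
        else if Γ.circleOf s.state (Γ.arcL e false) = Γ.circleOf s.state (Γ.arcR e false) ∧
            Γ.circleOf s'.state (Γ.arcL e false) ≠ Γ.circleOf s'.state (Γ.arcR e false) then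
          if s'.exponent (Γ.circleOf s'.state (Γ.arcL e false)) +
            s'.exponent (Γ.circleOf s'.state (Γ.arcR e false)) ≡
              s.exponent (Γ.circleOf s.state (Γ.arcL e false)) + 2 * (n / 2) [MOD n] then 1 else 0
        else if Γ.circleOf s.state (Γ.arcL e false) = Γ.circleOf s.state (Γ.arcR e false) ∧
            Γ.circleOf s'.state (Γ.arcL e false) = Γ.circleOf s'.state (Γ.arcR e false) then
          if s'.exponent (Γ.circleOf s'.state (Γ.arcL e false)) ≡
            s.exponent (Γ.circleOf s.state (Γ.arcL e false)) + n / 2 [MOD n] then sqrtn else 0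
        else 0
      else 0 := by
  -- in all of the cases the difference of the two sides is less than `2 * n` in one direction
  -- and less than `n` in the other, so a congruence means an equality for `t = 0` or `t = n`
  have key : ∀ (A B : ℕ) (c : k), A < B + n → B < A + 2 * n →
      (if A + 0 = B then c else 0) + (if A + n = B then c else 0) =
        if A ≡ B [MOD n] then c else 0 := by
    intro A B c h1 h2
    by_cases hAB : A ≡ B [MOD n]
    · rw [if_pos hAB]
      obtain ⟨q, hq⟩ := (Nat.modEq_iff_dvd.1 hAB)
      have hq1 : -1 < q := by
        have : (n : ℤ) * (-1) < n * q := by rw [← hq]; lia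
        exact lt_of_mul_lt_mul_left this (by positivity)
      have hq2 : q < 2 := by
        have : (n : ℤ) * q < n * 2 := by rw [← hq]; lia
        exact lt_of_mul_lt_mul_left this (by positivity)
      obtain rfl | rfl : q = 0 ∨ q = 1 := by lia
      · rw [if_pos (by lia), if_neg (by lia), add_zero]
      · rw [if_neg (by lia), if_pos (by lia), zero_add]
    · rw [if_neg hAB, if_neg, if_neg, add_zero]
      · rintro rfl
        exact hAB (by simp [Nat.ModEq])
      · rintro rfl
        exact hAB (by simp [Nat.ModEq])
  rw [edgeCoeff_eq, edgeCoeff_eq]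
  have hlt : ∀ {α : Γ.State} (a : Γ.Circle α → Fin n) c, (a c : ℕ) < n := fun a c => (a c).2
  by_cases h1 : Unchanged e s.exponent s'.exponent
  swap
  · simp only [if_neg h1, add_zero]
  simp only [if_pos h1]
  have l1 := hlt s.exponent (Γ.circleOf s.state (Γ.arcL e false))
  have l2 := hlt s.exponent (Γ.circleOf s.state (Γ.arcR e false))
  have l3 := hlt s'.exponent (Γ.circleOf s'.state (Γ.arcL e false))
  have l4 := hlt s'.exponent (Γ.circleOf s'.state (Γ.arcR e false))
  by_cases h2 : Γ.circleOf s.state (Γ.arcL e false) ≠ Γ.circleOf s.state (Γ.arcR e false) ∧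
      Γ.circleOf s'.state (Γ.arcL e false) = Γ.circleOf s'.state (Γ.arcR e false)
  · simp only [if_pos h2]
    exact key _ _ _ (by lia) (by lia)
  by_cases h3 : Γ.circleOf s.state (Γ.arcL e false) = Γ.circleOf s.state (Γ.arcR e false) ∧
      Γ.circleOf s'.state (Γ.arcL e false) ≠ Γ.circleOf s'.state (Γ.arcR e false)
  · simp only [if_neg h2, if_pos h3]
    exact key _ _ _ (by lia) (by lia)
  by_cases h4 : Γ.circleOf s.state (Γ.arcL e false) = Γ.circleOf s.state (Γ.arcR e false) ∧
      Γ.circleOf s'.state (Γ.arcL e false) = Γ.circleOf s'.state (Γ.arcR e false)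
  · simp only [if_neg h2, if_neg h3, if_pos h4]
    exact key _ _ _ (by lia) (by lia)
  · simp only [if_neg h2, if_neg h3, if_neg h4, add_zero]

end EdgeCoeff

/-! ### Sums over exponents and characters -/

section Sums

variable {n : ℕ} {A : Type*} [AddCommMonoid A] {α β : Γ.State} {e : Γ.MEdge}

theorem unchanged_iff {h : AgreeOff e α β} {a : Γ.Circle α → Fin n} {b : Γ.Circle β → Fin n} :
    Unchanged e a b ↔ ∀ c, Away e c → b c = a (Γ.circleOf α c.arc) := by
  constructor
  · intro hab c hc
    rw [← hab, circleOf_arc]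
    rwa [h.away_iff, circleOf_arc]
  · intro hb x hx
    rw [hb _ (h.away_imp hx), h.circleOf_arc_circleOf hx]

open Classical in
/-- An unchanged exponent function is determined by its value on the circle at `e`, if there is only
one. -/
theorem sum_unchanged_of_eq [Finite E] (h : AgreeOff e α β)
    (hβ : Γ.circleOf β (Γ.arcL e false) = Γ.circleOf β (Γ.arcR e false))
    (a : Γ.Circle α → Fin n) (G : Fin n → A) :
    (∑ b : Γ.Circle β → Fin n,
      if Unchanged e a b then G (b (Γ.circleOf β (Γ.arcL e false))) else 0) = ∑ y, G y := by
  rw [← Finset.sum_filter]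
  refine Finset.sum_nbij' (fun b => b (Γ.circleOf β (Γ.arcL e false)))
    (fun y c => if Away e c then a (Γ.circleOf α c.arc) else y) ?_ ?_ ?_ ?_ ?_
  · simp
  · intro y _
    rw [Finset.mem_filter, unchanged_iff (h := h)]
    exact ⟨Finset.mem_univ _, fun c hc => if_pos hc⟩
  · intro b hb
    rw [Finset.mem_filter, unchanged_iff (h := h)] at hb
    funext c
    by_cases hc : Away e c
    · simp only [if_pos hc, hb.2 c hc]
    · simp only [if_neg hc]
      simp only [Away, ← hβ, and_self, not_not] at hc
      rw [hc]
  · intro y _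
    simp only [if_neg (not_away_arc β e false).1]
  · simp

open Classical in
/-- An unchanged exponent function is determined by its values on the circles at `e`, if there are
two of them. -/
theorem sum_unchanged_of_ne [Finite E] (h : AgreeOff e α β)
    (hβ : Γ.circleOf β (Γ.arcL e false) ≠ Γ.circleOf β (Γ.arcR e false))
    (a : Γ.Circle α → Fin n) (G : Fin n → Fin n → A) :
    (∑ b : Γ.Circle β → Fin n,
      if Unchanged e a b then G (b (Γ.circleOf β (Γ.arcL e false)))
        (b (Γ.circleOf β (Γ.arcR e false))) else 0) = ∑ y, ∑ z, G y z := by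
  rw [← Finset.sum_filter, ← Fintype.sum_prod_type']
  refine Finset.sum_nbij'
    (fun b => (b (Γ.circleOf β (Γ.arcL e false)), b (Γ.circleOf β (Γ.arcR e false))))
    (fun y c => if Away e c then a (Γ.circleOf α c.arc) else
      if c = Γ.circleOf β (Γ.arcL e false) then y.1 else y.2) ?_ ?_ ?_ ?_ ?_
  · simp
  · intro y _
    rw [Finset.mem_filter, unchanged_iff (h := h)]
    exact ⟨Finset.mem_univ _, fun c hc => if_pos hc⟩
  · intro b hb
    rw [Finset.mem_filter, unchanged_iff (h := h)] at hb
    funext c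
    by_cases hc : Away e c
    · simp only [if_pos hc, hb.2 c hc]
    · simp only [if_neg hc]
      by_cases hc' : c = Γ.circleOf β (Γ.arcL e false)
      · rw [if_pos hc', hc']
      · rw [if_neg hc']
        have : c = Γ.circleOf β (Γ.arcR e false) := by
          by_contra hc''
          exact hc ⟨hc', hc''⟩
        rw [this]
  · intro y _
    simp only [if_neg (not_away_arc β e false).1, if_neg (not_away_arc β e false).2, if_true,
      if_neg hβ.symm]
  · simp

end Sums

end PerfectMatchingGraph

section RootsOfUnity

variable {K : Type*} [Field K] {n : ℕ}

theorem sum_modEq_pow (hn : 0 < n) {z : K} (hz : z ^ n = 1) (N : ℕ) :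
    (∑ y : Fin n, if (y : ℕ) ≡ N [MOD n] then z ^ (y : ℕ) else 0) = z ^ N := by
  rw [Finset.sum_eq_single ⟨N % n, Nat.mod_lt _ hn⟩]
  · rw [if_pos (Nat.mod_modEq _ _)]
    exact pow_eq_pow_of_modEq (Nat.mod_modEq _ _) hz
  · intro y _ hy
    rw [if_neg]
    intro h
    refine hy (Fin.ext ?_)
    rw [Nat.ModEq, Nat.mod_eq_of_lt y.2] at h
    exact h
  · simp

theorem sum_pow_eq_ite {z : K} (hz : z ^ n = 1) [Decidable (z = 1)] :
    ∑ y : Fin n, z ^ (y : ℕ) = if z = 1 then (n : K) else 0 := by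
  split_ifs with h
  · simp [h]
  · rw [Fin.sum_univ_eq_sum_range (fun i => z ^ i)]
    have := mul_neg_geom_sum z n
    rw [hz, sub_self] at this
    exact (mul_eq_zero.1 this).resolve_left (sub_ne_zero.2 (Ne.symm h))

theorem sum_sum_modEq_pow (hn : 0 < n) {z z' : K} (hz : z ^ n = 1) (hz' : z' ^ n = 1) (N : ℕ)
    [Decidable (z = z')] :
    (∑ x : Fin n, ∑ y : Fin n, if (x + y : ℕ) ≡ N [MOD n] then z ^ (x : ℕ) * z' ^ (y : ℕ) else 0) =
      if z = z' then n * z ^ N else 0 := by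
  classical
  have hz0 : z ≠ 0 := by
    rintro rfl
    simp [hn.ne'] at hz
  have h1 : ∀ y : Fin n,
      (∑ x : Fin n, if (x + y : ℕ) ≡ N [MOD n] then z ^ (x : ℕ) * z' ^ (y : ℕ) else 0) =
        z ^ N * (z' / z) ^ (y : ℕ) := by
    intro y
    have h2 : ∀ x : Fin n, (x + y : ℕ) ≡ N [MOD n] ↔ (x : ℕ) ≡ N + (n - y) [MOD n] := by
      intro x
      have hy := y.2.le
      have : (x + y : ℕ) + (n - y) ≡ N + (n - y) [MOD n] ↔ (x : ℕ) ≡ N + (n - y) [MOD n] := by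
        rw [add_assoc, Nat.add_sub_cancel' hy]
        simp [Nat.ModEq]
      rw [← this]
      exact ⟨fun h => h.add_right _, fun h => h.add_right_cancel' _⟩
    have h3 : z ^ (n - y : ℕ) = (z ^ (y : ℕ))⁻¹ := by
      refine eq_inv_of_mul_eq_one_left ?_
      rw [← pow_add, Nat.sub_add_cancel y.2.le, hz]
    calc _ = ∑ x : Fin n, (if (x : ℕ) ≡ N + (n - y) [MOD n] then z ^ (x : ℕ) else 0) *
          z' ^ (y : ℕ) := by
          refine Finset.sum_congr rfl fun x _ => ?_
          simp only [h2, ite_mul, zero_mul]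
      _ = _ := by
          rw [← Finset.sum_mul, sum_modEq_pow hn hz, pow_add, h3, div_pow]
          field_simp
  rw [Finset.sum_comm, Finset.sum_congr rfl fun y _ => h1 y, ← Finset.mul_sum,
    sum_pow_eq_ite (by rw [div_pow, hz, hz', div_one])]
  simp only [div_eq_one_iff_eq hz0, eq_comm (a := z')]
  split_ifs <;> ring

/-- Fourier inversion on a power of the cyclic group: a function that is orthogonal to all
characters vanishes. -/
theorem eq_zero_of_sum_character_eq_zero [NeZero (n : K)] {ζ : K} (hζ : IsPrimitiveRoot ζ n)
    {ι : Type*} [Fintype ι] [DecidableEq ι] (g : (ι → Fin n) → K)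
    (h : ∀ j : ι → Fin n, ∑ a, (∏ c, (ζ ^ (j c : ℕ)) ^ (a c : ℕ)) * g a = 0) : g = 0 := by
  funext a₀
  have key : ∀ a : ι → Fin n,
      ∑ j : ι → Fin n, ∏ c, (ζ ^ ((a c : ℕ) + (n - a₀ c))) ^ (j c : ℕ) =
        if a = a₀ then (n : K) ^ Fintype.card ι else 0 := by
    intro a
    have h1 := Finset.prod_univ_sum (fun _ : ι => (Finset.univ : Finset (Fin n)))
      (fun c y => (ζ ^ ((a c : ℕ) + (n - a₀ c))) ^ (y : ℕ))
    rw [Fintype.piFinset_univ] at h1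
    rw [← h1]
    have h2 : ∀ c, ∑ y : Fin n, (ζ ^ ((a c : ℕ) + (n - a₀ c))) ^ (y : ℕ) =
        if a c = a₀ c then (n : K) else 0 := by
      intro c
      classical
      rw [sum_pow_eq_ite (by rw [← pow_mul, mul_comm, pow_mul, hζ.pow_eq_one, one_pow])]
      refine if_congr ?_ rfl rfl
      rw [hζ.pow_eq_one_iff_dvd, Fin.ext_iff]
      have := (a c).2
      have := (a₀ c).2
      constructor
      · rintro ⟨q, hq⟩
        obtain rfl : q = 1 := by
          have h3 : 0 < n * q := by lia
          have h4 : n * q < n * 2 := by lia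
          have := Nat.lt_of_mul_lt_mul_left h4
          have := Nat.pos_of_mul_pos_left h3
          lia
        lia
      · intro h
        exact ⟨1, by lia⟩
    simp only [h2]
    split_ifs with h3
    · simp [h3]
    · obtain ⟨c, hc⟩ := Function.ne_iff.1 h3
      exact Finset.prod_eq_zero (Finset.mem_univ c) (if_neg hc)
  have h5 : ∑ j : ι → Fin n, (∏ c, ζ ^ ((n - a₀ c) * (j c : ℕ))) *
      ∑ a, (∏ c, (ζ ^ (j c : ℕ)) ^ (a c : ℕ)) * g a = 0 := by
    simp only [h, mul_zero, Finset.sum_const_zero]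
  simp only [Finset.mul_sum] at h5
  rw [Finset.sum_comm] at h5
  have h6 : ∀ a : ι → Fin n, ∑ j : ι → Fin n, (∏ c, ζ ^ ((n - a₀ c) * (j c : ℕ))) *
      ((∏ c, (ζ ^ (j c : ℕ)) ^ (a c : ℕ)) * g a) =
        (if a = a₀ then (n : K) ^ Fintype.card ι else 0) * g a := by
    intro a
    rw [← key, Finset.sum_mul]
    refine Finset.sum_congr rfl fun j _ => ?_
    rw [← mul_assoc, ← Finset.prod_mul_distrib]
    congr 2
    funext c
    ring
  simp only [h6, ite_mul, zero_mul, Finset.sum_ite_eq', Finset.mem_univ, if_true] at h5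
  exact (mul_eq_zero.1 h5).resolve_left (pow_ne_zero _ (NeZero.ne _))

end RootsOfUnity

namespace PerfectMatchingGraph

variable {V : Type w} {E : Type v} {Γ : PerfectMatchingGraph V E}

/-! ### The maps of the edges in the basis of characters -/

section Characters

variable {K : Type*} {n : ℕ} {α β : Γ.State} {e : Γ.MEdge}

/-- A labelling of the arcs is constant on the circles of a state. -/
def ConstantOn (α : Γ.State) (u : Γ.Arc → K) : Prop :=
  ∀ x y, Γ.circleOf α x = Γ.circleOf α y → u x = u y

theorem ConstantOn.apply_arc {u : Γ.Arc → K} (hu : ConstantOn α u) (x : Γ.Arc) :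
    u (Γ.circleOf α x).arc = u x := hu _ _ (circleOf_arc _)

theorem ConstantOn.of_agreeOff {u : Γ.Arc → K} (hu : ConstantOn β u) (h : AgreeOff e α β)
    (he : u (Γ.arcL e false) = u (Γ.arcR e false)) : ConstantOn α u := by
  intro x y hxy
  by_cases hx : Away e (Γ.circleOf α x)
  · exact hu _ _ (h.circleOf_eq hx hxy)
  · have key : ∀ x, ¬ Away e (Γ.circleOf α x) → u x = u (Γ.arcL e false) := by
      intro x hx
      rw [h.away_iff, Away, not_and_or, not_not, not_not] at hx
      rcases hx with hx | hx
      · exact hu _ _ hx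
      · exact (hu _ _ hx).trans he.symm
    rw [key x hx, key y (hxy ▸ hx)]

theorem ConstantOn.apply_arc_eq {u : Γ.Arc → K} (hu : ConstantOn β u) (h : AgreeOff e α β)
    {x : Γ.Arc} (hx : Away e (Γ.circleOf α x)) :
    u (Γ.circleOf β x).arc = u (Γ.circleOf α x).arc := by
  refine hu _ _ ?_
  rw [circleOf_arc]
  exact h.circleOf_eq hx (circleOf_arc _).symm

variable [Field K] [Finite E]

/-- The character of the exponents on the circles of `α` that is given by a labelling of the arcs
by roots of unity. -/
noncomputable def character (α : Γ.State) (u : Γ.Arc → K) (a : Γ.Circle α → Fin n) : K :=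
  ∏ c : Γ.Circle α, u c.arc ^ (a c : ℕ)

/-- The weight of a labelling: every circle with the label `z` contributes the factor
`√n * z ^ m`. -/
noncomputable def weight (n : ℕ) (s : K) (α : Γ.State) (u : Γ.Arc → K) : K :=
  ∏ c : Γ.Circle α, s * u c.arc ^ (n / 2)

theorem weight_ne_zero {s : K} (hs : s ≠ 0) {u : Γ.Arc → K} (hu : ∀ x, u x ≠ 0) :
    weight n s α u ≠ 0 :=
  Finset.prod_ne_zero_iff.2 fun _ _ => mul_ne_zero hs (pow_ne_zero _ (hu _))

open Classical in
/-- The pull-back of a character along the map of an edge of the hypercube is zero, unless the two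
sides of the matching edge have the same label; in that case it is a multiple of the character of
the same labelling.  The factor is the label's `√n * z ^ m`, times the quotient of
the weights. -/
theorem sum_character_mul_edgeCoeff [LinearOrder E] (hn : 0 < n) {s : K} (hs : s * s = n)
    (he : e ∉ α) {u : Γ.Arc → K} (hu : ConstantOn (insert e α) u) (hun : ∀ x, u x ^ n = 1)
    (a : Γ.Circle α → Fin n) :
    (∑ b : Γ.Circle (insert e α) → Fin n, character (insert e α) u b *
      (Γ.edgeCoeff n s 0 e ⟨α, a⟩ ⟨insert e α, b⟩ + Γ.edgeCoeff n s n e ⟨α, a⟩ ⟨insert e α, b⟩)) *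
        weight n s α u =
      if u (Γ.arcL e false) = u (Γ.arcR e false) then
        s * u (Γ.arcL e false) ^ (n / 2) * weight n s (insert e α) u * character α u a
      else 0 := by
  set β := insert e α with hβdef
  have h : AgreeOff e α β := agreeOff_insert α e
  have hpar := circleOf_eq_or_insert he
  rw [← hβdef] at hpar
  have hpL := hu.apply_arc (Γ.arcL e false)
  have hpR := hu.apply_arc (Γ.arcR e false)
  -- the contribution of the circles away from `e` to the characters
  set R := ∏ c : Γ.Circle α with Away e c, u c.arc ^ (a c : ℕ) with hR
  have hχ : ∀ b : Γ.Circle β → Fin n, Unchanged e a b → character β u b =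
      (if Γ.circleOf β (Γ.arcL e false) = Γ.circleOf β (Γ.arcR e false) then
        u (Γ.arcL e false) ^ (b (Γ.circleOf β (Γ.arcL e false)) : ℕ) else
        u (Γ.arcL e false) ^ (b (Γ.circleOf β (Γ.arcL e false)) : ℕ) *
          u (Γ.arcR e false) ^ (b (Γ.circleOf β (Γ.arcR e false)) : ℕ)) * R := by
    intro b hb
    rw [character, prod_circle_eq e, hpL, hpR, hR]
    congr 1
    exact h.prod_away_eq fun x hx => by rw [hb x hx, hu.apply_arc_eq h hx]
  have hw : ∏ c : Γ.Circle β with Away e c, s * u c.arc ^ (n / 2) =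
      ∏ c : Γ.Circle α with Away e c, s * u c.arc ^ (n / 2) :=
    h.prod_away_eq fun x hx => by rw [hu.apply_arc_eq h hx]
  simp only [edgeCoeff_add_edgeCoeff hn]
  by_cases hq : Γ.circleOf β (Γ.arcL e false) = Γ.circleOf β (Γ.arcR e false)
  · have huLR := hu _ _ hq
    rw [if_pos huLR]
    have hα := hu.of_agreeOff h huLR
    have hαL := hα.apply_arc (Γ.arcL e false)
    have hαR := hα.apply_arc (Γ.arcR e false)
    by_cases hp : Γ.circleOf α (Γ.arcL e false) = Γ.circleOf α (Γ.arcR e false)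
    · -- a new double point
      have hsum := sum_unchanged_of_eq h hq a (A := K) (fun y : Fin n =>
        if (y : ℕ) ≡ a (Γ.circleOf α (Γ.arcL e false)) + n / 2 [MOD n] then
          u (Γ.arcL e false) ^ (y : ℕ) else 0)
      rw [sum_modEq_pow hn (hun _)] at hsum
      calc _ = (∑ b : Γ.Circle β → Fin n, if Unchanged e a b then
            (if (b (Γ.circleOf β (Γ.arcL e false)) : ℕ) ≡
              a (Γ.circleOf α (Γ.arcL e false)) + n / 2 [MOD n] then
                u (Γ.arcL e false) ^ (b (Γ.circleOf β (Γ.arcL e false)) : ℕ) else 0) else 0) *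
                  (R * s) * weight n s α u := by
            congr 1
            rw [Finset.sum_mul]
            refine Finset.sum_congr rfl fun b _ => ?_
            by_cases hb : Unchanged e a b
            · rw [hχ b hb]
              simp only [hb, hp, hq, if_true, ne_eq, not_true, and_false, if_false,
                and_true]
              split_ifs <;> ring
            · simp only [hb, if_false, mul_zero, zero_mul]
        _ = _ := by
            rw [hsum, weight, weight, prod_circle_eq e, prod_circle_eq e, if_pos hp, if_pos hq, hw,
              character, prod_circle_eq e, if_pos hp, hαL, hpL, pow_add]
            ring
    · -- two circles are fused
      have hsum := sum_unchanged_of_eq h hq a (A := K) (fun y : Fin n =>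
        if (y : ℕ) ≡ a (Γ.circleOf α (Γ.arcL e false)) + a (Γ.circleOf α (Γ.arcR e false)) [MOD n]
          then u (Γ.arcL e false) ^ (y : ℕ) else 0)
      rw [sum_modEq_pow hn (hun _)] at hsum
      calc _ = (∑ b : Γ.Circle β → Fin n, if Unchanged e a b then
            (if (b (Γ.circleOf β (Γ.arcL e false)) : ℕ) ≡
              a (Γ.circleOf α (Γ.arcL e false)) + a (Γ.circleOf α (Γ.arcR e false)) [MOD n] then
                u (Γ.arcL e false) ^ (b (Γ.circleOf β (Γ.arcL e false)) : ℕ) else 0) else 0) *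
                  R * weight n s α u := by
            congr 1
            rw [Finset.sum_mul]
            refine Finset.sum_congr rfl fun b _ => ?_
            by_cases hb : Unchanged e a b
            · rw [hχ b hb]
              simp only [hb, hp, hq, if_true, ne_eq, not_false_eq_true, true_and]
              split_ifs <;> ring
            · simp only [hb, if_false, mul_zero, zero_mul]
        _ = _ := by
            rw [hsum, weight, weight, prod_circle_eq e, prod_circle_eq e, if_neg hp, if_pos hq, hw,
              character, prod_circle_eq e, if_neg hp, hαL, hαR, hpL, ← huLR, pow_add]
            ring
  · -- a circle is split
    have hp := hpar.resolve_right hq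
    have hsum := sum_unchanged_of_ne h hq a (A := K) (fun y z : Fin n =>
      if (y + z : ℕ) ≡ a (Γ.circleOf α (Γ.arcL e false)) + 2 * (n / 2) [MOD n] then
        u (Γ.arcL e false) ^ (y : ℕ) * u (Γ.arcR e false) ^ (z : ℕ) else 0)
    rw [sum_sum_modEq_pow hn (hun _) (hun _)] at hsum
    calc _ = (∑ b : Γ.Circle β → Fin n, if Unchanged e a b then
          (if (b (Γ.circleOf β (Γ.arcL e false)) + b (Γ.circleOf β (Γ.arcR e false)) : ℕ) ≡
            a (Γ.circleOf α (Γ.arcL e false)) + 2 * (n / 2) [MOD n] then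
              u (Γ.arcL e false) ^ (b (Γ.circleOf β (Γ.arcL e false)) : ℕ) *
                u (Γ.arcR e false) ^ (b (Γ.circleOf β (Γ.arcR e false)) : ℕ) else 0) else 0) *
                  R * weight n s α u := by
          congr 1
          rw [Finset.sum_mul]
          refine Finset.sum_congr rfl fun b _ => ?_
          by_cases hb : Unchanged e a b
          · rw [hχ b hb]
            simp only [hb, hp, hq, if_true, ne_eq, not_true, false_and, if_false, true_and,
              not_false_eq_true]
            split_ifs <;> ring
          · simp only [hb, if_false, mul_zero, zero_mul]
      _ = _ := by
          rw [hsum]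
          split_ifs with huLR
          · have hα := hu.of_agreeOff h huLR
            have hαL := hα.apply_arc (Γ.arcL e false)
            rw [weight, weight, prod_circle_eq e, prod_circle_eq e, if_pos hp, if_neg hq, hw,
              character, prod_circle_eq e, if_pos hp, hαL, hpL, hpR, ← huLR, pow_add, ← hs,
              two_mul, pow_add]
            ring
          · simp

end Characters

end PerfectMatchingGraph

namespace PerfectMatchingGraph

variable {V : Type w} {E : Type v} {Γ : PerfectMatchingGraph V E}

/-! ### The squares of the differentials -/

section Square

open Classical in
theorem sum_enhancedState [Fintype E] [LinearOrder E] {n : ℕ} {A : Type*} [AddCommMonoid A]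
    (g : Γ.EnhancedState n → A) : ∑ s, g s = ∑ α, ∑ a, g ⟨α, a⟩ := by
  rw [← Fintype.sum_sigma' (fun α a => g ⟨α, a⟩)]
  let φ : (Σ α : Γ.State, (Γ.Circle α → Fin n)) ≃ Γ.EnhancedState n :=
    ⟨fun p => ⟨p.1, p.2⟩, fun s => ⟨s.state, s.exponent⟩, fun _ => rfl, fun _ => rfl⟩
  exact (Fintype.sum_equiv φ _ _ fun _ => rfl).symm

variable {n : ℕ}

/-- The sign of the edge of the hypercube at `e` that ends in the state `γ`. -/
def edgeSign [LinearOrder E] (k : Type*) [CommRing k] (γ : Γ.State) (e : Γ.MEdge) : k :=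
  (-1) ^ (γ.filter (· < e)).card

/-- The two paths around a face of the hypercube have opposite signs. -/
theorem edgeSign_mul_edgeSign [LinearOrder E] {k : Type*} [CommRing k] {γ : Γ.State} {e f : Γ.MEdge} (he : e ∈ γ)
    (hf : f ∈ γ) (hef : e ≠ f) :
    edgeSign k γ e * edgeSign k (γ.erase e) f = -(edgeSign k γ f * edgeSign k (γ.erase f) e) := by
  wlog h : e < f generalizing e f
  · rw [this hf he hef.symm (lt_of_le_of_ne (not_lt.1 h) hef.symm), neg_neg]
  have h1 : (γ.erase f).filter (· < e) = γ.filter (· < e) := by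
    ext x
    simp only [Finset.mem_filter, Finset.mem_erase]
    exact ⟨fun hx => ⟨hx.1.2, hx.2⟩, fun hx => ⟨⟨(hx.2.trans h).ne, hx.1⟩, hx.2⟩⟩
  have h2 : (γ.filter (· < f)).card = ((γ.erase e).filter (· < f)).card + 1 := by
    rw [← Finset.card_erase_add_one (a := e) (by simp [he, h]), Finset.filter_erase]
  simp only [edgeSign, h1, h2, pow_succ]
  ring

/-- The matrix of `∂̂`. -/
noncomputable def hatMatrix [LinearOrder E] (Γ : PerfectMatchingGraph V E) {k : Type*} [CommRing k] (n : ℕ)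
    (sqrtn : k) : Matrix (Γ.EnhancedState n) (Γ.EnhancedState n) k :=
  Matrix.of fun s' s => ∑ e : Γ.MEdge, if e ∉ s.state ∧ s'.state = insert e s.state then
    (-1 : k) ^ (s.state.filter (· < e)).card *
      (Γ.edgeCoeff n sqrtn 0 e s s' + Γ.edgeCoeff n sqrtn n e s s') else 0

theorem hatMatrix_map [LinearOrder E] {k l : Type*} [CommRing k] [CommRing l] (f : k →+* l) (sqrtn : k) :
    (hatMatrix Γ n sqrtn).map f = hatMatrix Γ n (f sqrtn) := by
  ext s' s
  simp only [hatMatrix, Matrix.map_apply, Matrix.of_apply, map_sum, apply_ite f, map_mul, map_add,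
    map_zero, map_pow, map_neg, map_one, edgeCoeff_map]

variable [Fintype E]

theorem hypercubeMap_apply [LinearOrder E] {k : Type*} [CommRing k] (sqrtn : k) (t : ℕ) (f : Γ.Chain k n)
    (s' : Γ.EnhancedState n) :
    Γ.hypercubeMap n sqrtn t f s' = ∑ s : Γ.EnhancedState n, (∑ e : Γ.MEdge,
      if e ∉ s.state ∧ s'.state = insert e s.state then
        (-1 : k) ^ (s.state.filter (· < e)).card * Γ.edgeCoeff n sqrtn t e s s'
      else 0) * f s := rfl

open Classical in
theorem hypercubeMap_apply_eq_sum [LinearOrder E] {k : Type*} [CommRing k] (sqrtn : k) (t : ℕ) (f : Γ.Chain k n)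
    (γ : Γ.State) (b : Γ.Circle γ → Fin n) :
    Γ.hypercubeMap n sqrtn t f ⟨γ, b⟩ = ∑ e : Γ.MEdge, if e ∈ γ then
      edgeSign k γ e * ∑ a : Γ.Circle (γ.erase e) → Fin n,
        Γ.edgeCoeff n sqrtn t e ⟨γ.erase e, a⟩ ⟨γ, b⟩ * f ⟨γ.erase e, a⟩ else 0 := by
  rw [hypercubeMap_apply]
  simp only [Finset.sum_mul]
  rw [Finset.sum_comm]
  refine Finset.sum_congr rfl fun e _ => ?_
  rw [sum_enhancedState]
  split_ifs with he
  · rw [Finset.sum_eq_single (γ.erase e)]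
    · rw [Finset.mul_sum]
      refine Finset.sum_congr rfl fun a _ => ?_
      rw [if_pos ⟨Finset.notMem_erase _ _, (Finset.insert_erase he).symm⟩, mul_assoc, edgeSign,
        Finset.filter_erase, Finset.erase_eq_of_notMem (a := e) (by simp)]
    · intro α _ hα
      refine Finset.sum_eq_zero fun a _ => ?_
      rw [if_neg, zero_mul]
      rintro ⟨h1, h2⟩
      simp only at h1 h2
      exact hα (by rw [h2, Finset.erase_insert h1])
    · simp
  · refine Finset.sum_eq_zero fun α _ => Finset.sum_eq_zero fun a _ => ?_
    rw [if_neg, zero_mul]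
    rintro ⟨h1, h2⟩
    simp only at h2
    exact he (by rw [h2]; exact Finset.mem_insert_self _ _)

variable {K : Type*} [Field K]

open Classical in
/-- The pairing of the part of a chain in the state `α` with the normalized character of a
labelling. -/
noncomputable def pairing (s : K) (α : Γ.State) (u : Γ.Arc → K) (f : Γ.Chain K n) : K :=
  (weight n s α u)⁻¹ * ∑ a, character α u a * f ⟨α, a⟩

theorem pairing_delHat [LinearOrder E] (hn : 0 < n) (hnK : (n : K) ≠ 0) {s : K} (hs : s * s = n) {γ : Γ.State}
    {u : Γ.Arc → K} (hu : ConstantOn γ u) (hun : ∀ x, u x ^ n = 1) (f : Γ.Chain K n) :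
    pairing s γ u (Γ.delHat n s f) = ∑ e : Γ.MEdge, open Classical in
      if e ∈ γ ∧ u (Γ.arcL e false) = u (Γ.arcR e false) then
        edgeSign K γ e * (s * u (Γ.arcL e false) ^ (n / 2)) * pairing s (γ.erase e) u f else 0 := by
  classical
  have hs0 : s ≠ 0 := by
    rintro rfl
    exact hnK (by rw [← hs, zero_mul])
  have hu0 : ∀ x, u x ≠ 0 := by
    intro x hx
    have := hun x
    rw [hx, zero_pow hn.ne'] at this
    exact zero_ne_one this
  have hadd : ∀ b, Γ.delHat n s f ⟨γ, b⟩ = ∑ e : Γ.MEdge, if e ∈ γ then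
      edgeSign K γ e * ∑ a : Γ.Circle (γ.erase e) → Fin n,
        (Γ.edgeCoeff n s 0 e ⟨γ.erase e, a⟩ ⟨γ, b⟩ + Γ.edgeCoeff n s n e ⟨γ.erase e, a⟩ ⟨γ, b⟩) *
          f ⟨γ.erase e, a⟩ else 0 := by
    intro b
    have : Γ.delHat n s f ⟨γ, b⟩ =
      Γ.hypercubeMap n s 0 f ⟨γ, b⟩ + Γ.hypercubeMap n s n f ⟨γ, b⟩ := rfl
    rw [this, hypercubeMap_apply_eq_sum, hypercubeMap_apply_eq_sum, ← Finset.sum_add_distrib]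
    refine Finset.sum_congr rfl fun e _ => ?_
    split_ifs
    · simp only [add_mul, Finset.sum_add_distrib, mul_add]
    · simp
  simp only [pairing, hadd, Finset.mul_sum]
  rw [Finset.sum_comm]
  refine Finset.sum_congr rfl fun e _ => ?_
  by_cases he : e ∈ γ
  swap
  · simp [he]
  simp only [he, if_true, true_and]
  obtain ⟨α, hα, rfl⟩ : ∃ α, e ∉ α ∧ γ = insert e α :=
    ⟨γ.erase e, Finset.notMem_erase _ _, (Finset.insert_erase he).symm⟩
  rw [Finset.erase_insert hα]
  have key : ∀ a, (∑ b : Γ.Circle (insert e α) → Fin n, character (insert e α) u b *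
      (Γ.edgeCoeff n s 0 e ⟨α, a⟩ ⟨insert e α, b⟩ + Γ.edgeCoeff n s n e ⟨α, a⟩ ⟨insert e α, b⟩)) =
      if u (Γ.arcL e false) = u (Γ.arcR e false) then
        s * u (Γ.arcL e false) ^ (n / 2) * weight n s (insert e α) u * character α u a *
          (weight n s α u)⁻¹
      else 0 := by
    intro a
    have := sum_character_mul_edgeCoeff hn hs hα hu hun a
    rw [← eq_mul_inv_iff_mul_eq₀ (weight_ne_zero hs0 hu0)] at this
    rw [this]
    split_ifs <;> simp
  have hW : weight n s (insert e α) u ≠ 0 := weight_ne_zero hs0 hu0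
  calc _ = (weight n s (insert e α) u)⁻¹ * edgeSign K (insert e α) e *
        ∑ a, (∑ b : Γ.Circle (insert e α) → Fin n, character (insert e α) u b *
      (Γ.edgeCoeff n s 0 e ⟨α, a⟩ ⟨insert e α, b⟩ + Γ.edgeCoeff n s n e ⟨α, a⟩ ⟨insert e α, b⟩)) *
        f ⟨α, a⟩ := by
        simp only [Finset.mul_sum, Finset.sum_mul]
        rw [Finset.sum_comm]
        refine Finset.sum_congr rfl fun b _ => Finset.sum_congr rfl fun a _ => ?_
        ring
    _ = _ := by
        simp only [key]
        split_ifs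
        · simp only [Finset.mul_sum]
          refine Finset.sum_congr rfl fun b _ => ?_
          field_simp
        · simp

theorem pairing_delHat_delHat [LinearOrder E] [CharZero K] (hn : 0 < n) {s : K} (hs : s * s = n)
    {γ : Γ.State} {u : Γ.Arc → K} (hu : ConstantOn γ u) (hun : ∀ x, u x ^ n = 1)
    (f : Γ.Chain K n) : pairing s γ u (Γ.delHat n s (Γ.delHat n s f)) = 0 := by
  classical
  have hnK : (n : K) ≠ 0 := by exact_mod_cast hn.ne'
  let P : Γ.MEdge → Prop := fun e => u (Γ.arcL e false) = u (Γ.arcR e false)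
  let g : Γ.MEdge → Γ.MEdge → K := fun e e' =>
    if (e ∈ γ ∧ P e) ∧ e' ∈ γ.erase e ∧ P e' then
      edgeSign K γ e * (s * u (Γ.arcL e false) ^ (n / 2)) *
        (edgeSign K (γ.erase e) e' * (s * u (Γ.arcL e' false) ^ (n / 2)) *
          pairing s ((γ.erase e).erase e') u f) else 0
  have h1 : pairing s γ u (Γ.delHat n s (Γ.delHat n s f)) = ∑ e, ∑ e', g e e' := by
    rw [pairing_delHat hn hnK hs hu hun]
    refine Finset.sum_congr rfl fun e _ => ?_
    by_cases he : e ∈ γ ∧ P e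
    · have hagree : AgreeOff e (γ.erase e) γ := fun f hf => by simp [hf]
      rw [if_pos he, pairing_delHat hn hnK hs (hu.of_agreeOff hagree he.2) hun, Finset.mul_sum]
      refine Finset.sum_congr rfl fun e' _ => ?_
      simp only [g, he, true_and, mul_ite, mul_zero, and_self]
      rfl
    · rw [if_neg he]
      simp [g, he]
  have h2 : ∀ e e', g e e' = -g e' e := by
    intro e e'
    by_cases hc : (e ∈ γ ∧ P e) ∧ e' ∈ γ.erase e ∧ P e'
    · have hc' : (e' ∈ γ ∧ P e') ∧ e ∈ γ.erase e' ∧ P e := by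
        simp only [Finset.mem_erase] at hc ⊢
        tauto
      simp only [g]
      rw [if_pos hc, if_pos hc', Finset.erase_right_comm]
      have := edgeSign_mul_edgeSign (k := K) hc.1.1 hc'.1.1 (Finset.ne_of_mem_erase hc'.2.1)
      linear_combination (s * u (Γ.arcL e false) ^ (n / 2)) * (s * u (Γ.arcL e' false) ^ (n / 2)) *
          pairing s ((γ.erase e').erase e) u f * this
    · have hc' : ¬ ((e' ∈ γ ∧ P e') ∧ e ∈ γ.erase e' ∧ P e) := by
        simp only [Finset.mem_erase] at hc ⊢
        tauto
      simp only [g]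
      rw [if_neg hc, if_neg hc', neg_zero]
  rw [h1]
  -- the sum over ordered pairs of matching edges is antisymmetric
  have h3 : ∑ e, ∑ e', g e e' = -∑ e, ∑ e', g e e' := by
    conv_lhs => rw [Finset.sum_comm]
    rw [← Finset.sum_neg_distrib]
    refine Finset.sum_congr rfl fun e _ => ?_
    rw [← Finset.sum_neg_distrib]
    exact Finset.sum_congr rfl fun e' _ => h2 _ _
  exact self_eq_neg.1 h3

theorem eq_zero_of_pairing_eq_zero [CharZero K] (hn : 0 < n) {ζ : K} (hζ : IsPrimitiveRoot ζ n)
    {s : K} (hs : s * s = n) {g : Γ.Chain K n}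
    (h : ∀ γ u, ConstantOn γ u → (∀ x, u x ^ n = 1) → pairing s γ u g = 0) : g = 0 := by
  classical
  have hnK : (n : K) ≠ 0 := by exact_mod_cast hn.ne'
  have : NeZero (n : K) := ⟨hnK⟩
  have hs0 : s ≠ 0 := by
    rintro rfl
    exact hnK (by rw [← hs, zero_mul])
  have hζ0 : ζ ≠ 0 := hζ.ne_zero hn.ne'
  have key : ∀ γ, (fun a => g ⟨γ, a⟩) = 0 := by
    intro γ
    refine eq_zero_of_sum_character_eq_zero hζ _ fun j => ?_
    let u : Γ.Arc → K := fun x => ζ ^ (j (Γ.circleOf γ x) : ℕ)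
    have h1 := h γ u (fun x y hxy => by simp only [u, hxy]) (fun x => by
      simp only [u]
      rw [← pow_mul, mul_comm, pow_mul, hζ.pow_eq_one, one_pow])
    have h2 := (mul_eq_zero.1 h1).resolve_left
      (inv_ne_zero (weight_ne_zero hs0 fun x => pow_ne_zero _ hζ0))
    simpa only [character, u, circleOf_arc] using h2
  funext ⟨γ, a⟩
  exact congrFun (key γ) a

theorem delHat_delHat_of_isPrimitiveRoot [LinearOrder E] [CharZero K] (hn : 0 < n) {ζ : K}
    (hζ : IsPrimitiveRoot ζ n) {s : K} (hs : s * s = n) (f : Γ.Chain K n) :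
    Γ.delHat n s (Γ.delHat n s f) = 0 :=
  eq_zero_of_pairing_eq_zero hn hζ hs fun _ _ hu hun => pairing_delHat_delHat hn hs hu hun f

theorem delHat_apply [LinearOrder E] {k : Type*} [CommRing k] (sqrtn : k) (f : Γ.Chain k n) :
    Γ.delHat n sqrtn f = (hatMatrix Γ n sqrtn).mulVec f := by
  have : hatMatrix Γ n sqrtn = Matrix.of (fun s' s : Γ.EnhancedState n =>
      ∑ e : Γ.MEdge, if e ∉ s.state ∧ s'.state = insert e s.state then
        (-1 : k) ^ (s.state.filter (· < e)).card * Γ.edgeCoeff n sqrtn 0 e s s' else 0) +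
      Matrix.of (fun s' s : Γ.EnhancedState n =>
        ∑ e : Γ.MEdge, if e ∉ s.state ∧ s'.state = insert e s.state then
          (-1 : k) ^ (s.state.filter (· < e)).card * Γ.edgeCoeff n sqrtn n e s s' else 0) := by
    ext s' s
    simp only [hatMatrix, Matrix.add_apply, Matrix.of_apply]
    rw [← Finset.sum_add_distrib]
    refine Finset.sum_congr rfl fun e _ => ?_
    split_ifs
    · rw [mul_add]
    · simp
  rw [this, Matrix.add_mulVec]
  rfl

theorem hatMatrix_mul_hatMatrix_complex [LinearOrder E] (hn : 0 < n) {s : ℂ} (hs : s * s = n) :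
    hatMatrix Γ n s * hatMatrix Γ n s = 0 := by
  classical
  refine Matrix.toLin'.injective (LinearMap.ext fun f => ?_)
  rw [Matrix.toLin'_mul_apply, Matrix.toLin'_apply, Matrix.toLin'_apply, ← delHat_apply,
    ← delHat_apply, map_zero, LinearMap.zero_apply]
  exact delHat_delHat_of_isPrimitiveRoot hn (Complex.isPrimitiveRoot_exp n hn.ne') hs f

open Polynomial in
theorem _root_.Polynomial.aeval_eq_of_sqrt {A : Type*} [CommRing A] {s : A} (hs : s * s = n)
    (p : ℤ[X]) : aeval s p = ((p %ₘ (X ^ 2 - C (n : ℤ))).coeff 0 : A) +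
      (p %ₘ (X ^ 2 - C (n : ℤ))).coeff 1 * s := by
  have hmonic : (X ^ 2 - C (n : ℤ) : ℤ[X]).Monic := monic_X_pow_sub_C _ two_ne_zero
  have hdeg : (p %ₘ (X ^ 2 - C (n : ℤ))).natDegree < 2 := by
    have := natDegree_modByMonic_lt p hmonic (by
      intro h1
      have := congrArg natDegree h1
      rw [natDegree_X_pow_sub_C, natDegree_one] at this
      exact two_ne_zero this)
    rwa [natDegree_X_pow_sub_C] at this
  have h1 : aeval s p = aeval s (p %ₘ (X ^ 2 - C (n : ℤ))) := by
    have h0 : aeval s (X ^ 2 - C (n : ℤ)) = 0 := by simp [pow_two, hs]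
    conv_lhs => rw [← modByMonic_add_div p (X ^ 2 - C (n : ℤ))]
    rw [map_add, map_mul, h0, zero_mul, add_zero]
  rw [h1, aeval_eq_sum_range' hdeg, Finset.sum_range_succ, Finset.sum_range_one]
  simp

open Polynomial in
/-- An integral polynomial that vanishes at both complex square roots of `n` vanishes at a square
root of `n` in any ring. -/
theorem _root_.Polynomial.aeval_eq_zero_of_sqrt {k : Type*} [CommRing k] (hn : 0 < n) {sqrtn : k}
    (hs : sqrtn * sqrtn = (n : k)) {p : ℤ[X]}
    (h : ∀ s : ℂ, s * s = n → aeval s p = 0) : aeval sqrtn p = 0 := by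
  obtain ⟨s, hs'⟩ := IsAlgClosed.exists_pow_nat_eq (n : ℂ) two_pos
  rw [pow_two] at hs'
  have hs0 : s ≠ 0 := by
    rintro rfl
    rw [zero_mul] at hs'
    exact hn.ne' (by exact_mod_cast hs'.symm)
  have h1 := h s hs'
  have hs'' : -s * -s = n := by rw [neg_mul_neg, hs']
  have h2 := h (-s) hs''
  rw [aeval_eq_of_sqrt hs'] at h1
  rw [aeval_eq_of_sqrt hs''] at h2
  rw [aeval_eq_of_sqrt hs]
  set q := p %ₘ (X ^ 2 - C (n : ℤ))
  have h3 : (q.coeff 0 : ℂ) = 0 := by linear_combination (h1 + h2) / 2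
  have h4 : (q.coeff 1 : ℂ) = 0 := by
    have : (q.coeff 1 : ℂ) * s = 0 := by linear_combination (h1 - h2) / 2
    exact (mul_eq_zero.1 this).resolve_right hs0
  have h5 : q.coeff 0 = 0 := by exact_mod_cast h3
  have h6 : q.coeff 1 = 0 := by exact_mod_cast h4
  simp [h5, h6]

open Polynomial in
theorem hatMatrix_mul_hatMatrix_apply [LinearOrder E] {k : Type*} [CommRing k] (s : k) (s'' t : Γ.EnhancedState n) :
    (hatMatrix Γ n s * hatMatrix Γ n s) s'' t =
      aeval s ((hatMatrix Γ n (X : ℤ[X]) * hatMatrix Γ n (X : ℤ[X]) : Matrix _ _ ℤ[X]) s'' t) := by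
  have h1 : hatMatrix Γ n s = (hatMatrix Γ n (X : ℤ[X])).map (aeval (R := ℤ) s).toRingHom := by
    rw [hatMatrix_map]
    simp
  rw [h1, ← Matrix.map_mul]
  rfl

open Polynomial in
theorem hatMatrix_mul_hatMatrix [LinearOrder E] {k : Type*} [CommRing k] (hn : 0 < n) {sqrtn : k}
    (hs : sqrtn * sqrtn = (n : k)) : hatMatrix Γ n sqrtn * hatMatrix Γ n sqrtn = 0 := by
  ext s'' t
  rw [hatMatrix_mul_hatMatrix_apply, Matrix.zero_apply]
  refine aeval_eq_zero_of_sqrt hn hs fun s hs => ?_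
  rw [← hatMatrix_mul_hatMatrix_apply, hatMatrix_mul_hatMatrix_complex hn hs, Matrix.zero_apply]

end Square

end PerfectMatchingGraph

namespace PerfectMatchingGraph

variable {V : Type w} {E : Type v} {Γ : PerfectMatchingGraph V E} {k : Type u} [CommRing k] {n : ℕ} {sqrtn : k}

/-! ### Homogeneous components -/

section Component

variable [Finite E]

theorem filt_antitone : Antitone (Γ.filt k n) := fun _ _ hj _ hf s hs => hj.trans (hf s hs)

theorem bipart_le_hpart (i j : ℤ) : Γ.bipart k n i j ≤ Γ.hpart k n i :=
  fun _ hf s hs => (hf s hs).1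

theorem bipart_le_filt (i j : ℤ) : Γ.bipart k n i j ≤ Γ.filt k n j :=
  fun _ hf s hs => (hf s hs).2.ge

open Classical in
/-- The part of a chain that is supported in the quantum degrees in `P`. -/
noncomputable def component (Γ : PerfectMatchingGraph V E) (k : Type u) [CommRing k] (n : ℕ)
    (P : Set ℤ) : Γ.Chain k n →ₗ[k] Γ.Chain k n where
  toFun f s := if s.qdeg ∈ P then f s else 0
  map_add' f g := by
    funext s
    simp only [Pi.add_apply]
    split_ifs <;> simp
  map_smul' c f := by
    funext s
    simp

theorem component_apply_of_mem {P : Set ℤ} {f : Γ.Chain k n} {s : Γ.EnhancedState n}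
    (h : s.qdeg ∈ P) : Γ.component k n P f s = f s := if_pos h

theorem component_apply_of_notMem {P : Set ℤ} {f : Γ.Chain k n} {s : Γ.EnhancedState n}
    (h : s.qdeg ∉ P) : Γ.component k n P f s = 0 := if_neg h

theorem component_ne_zero {P : Set ℤ} {f : Γ.Chain k n} {s : Γ.EnhancedState n}
    (h : Γ.component k n P f s ≠ 0) : s.qdeg ∈ P ∧ f s ≠ 0 := by
  by_cases hs : s.qdeg ∈ P
  · rw [component_apply_of_mem hs] at h
    exact ⟨hs, h⟩
  · exact absurd (component_apply_of_notMem hs) h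

theorem component_mem_hpart {P : Set ℤ} {f : Γ.Chain k n} {i : ℤ} (hf : f ∈ Γ.hpart k n i) :
    Γ.component k n P f ∈ Γ.hpart k n i := fun s hs => hf s (component_ne_zero hs).2

theorem component_mem_filt {P : Set ℤ} {f : Γ.Chain k n} {j : ℤ} (hf : f ∈ Γ.filt k n j) :
    Γ.component k n P f ∈ Γ.filt k n j := fun s hs => hf s (component_ne_zero hs).2

theorem component_singleton_mem_bipart {f : Γ.Chain k n} {i : ℤ} (hf : f ∈ Γ.hpart k n i) (j : ℤ) :
    Γ.component k n {j} f ∈ Γ.bipart k n i j := fun s hs =>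
  ⟨hf s (component_ne_zero hs).2, (component_ne_zero hs).1⟩

theorem component_singleton_eq_self {f : Γ.Chain k n} {i j : ℤ} (hf : f ∈ Γ.bipart k n i j) :
    Γ.component k n {j} f = f := by
  funext s
  by_cases hs : s.qdeg = j
  · exact component_apply_of_mem hs
  · rw [component_apply_of_notMem hs]
    by_contra hne
    exact hs (hf s (Ne.symm hne)).2

theorem component_singleton_eq_zero_iff {f : Γ.Chain k n} {j : ℤ} (hf : f ∈ Γ.filt k n j) :
    Γ.component k n {j} f = 0 ↔ f ∈ Γ.filt k n (j + 1) := by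
  constructor
  · intro h s hs
    have h1 := hf s hs
    rcases h1.lt_or_eq with h2 | h2
    · exact h2
    · exact absurd ((component_apply_of_mem (P := {j}) h2.symm).symm.trans (congrFun h s)) hs
  · intro h
    funext s
    by_contra hne
    have h1 := component_ne_zero hne
    have h2 := h s h1.2
    have h3 : s.qdeg = j := h1.1
    lia

theorem sub_component_singleton_mem {f : Γ.Chain k n} {j : ℤ} (hf : f ∈ Γ.filt k n j) :
    f - Γ.component k n {j} f ∈ Γ.filt k n (j + 1) := by
  rw [← component_singleton_eq_zero_iff (sub_mem hf (component_mem_filt hf)), map_sub, sub_eq_zero]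
  funext s
  by_cases hs : s.qdeg ∈ ({j} : Set ℤ)
  · rw [component_apply_of_mem hs, component_apply_of_mem hs, component_apply_of_mem hs]
  · rw [component_apply_of_notMem hs, component_apply_of_notMem hs]

end Component

/-! ### The bigrading -/

variable [Fintype E] [LinearOrder E]

theorem hdeg_qdeg_of_matrixCoeff_ne_zero {t : ℕ} {s s' : Γ.EnhancedState n}
    (h : (∑ e : Γ.MEdge, if e ∉ s.state ∧ s'.state = insert e s.state then
        (-1 : k) ^ (s.state.filter (· < e)).card * Γ.edgeCoeff n sqrtn t e s s' else 0) ≠ 0) :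
    s'.hdeg = s.hdeg + 1 ∧ s'.qdeg = s.qdeg + t := by
  obtain ⟨e, -, he⟩ := Finset.exists_ne_zero_of_sum_ne_zero h
  rw [ne_eq, ite_eq_right_iff, Classical.not_imp] at he
  obtain ⟨⟨h1, h2⟩, h3⟩ := he
  refine ⟨?_, qdeg_eq_of_edgeCoeff_ne_zero h1 h2 (right_ne_zero_of_mul h3)⟩
  rw [EnhancedState.hdeg, EnhancedState.hdeg, h2, Finset.card_insert_of_notMem h1]
  push_cast
  rfl

theorem exists_of_hypercubeMap_ne_zero {t : ℕ} {f : Γ.Chain k n} {s' : Γ.EnhancedState n}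
    (h : Γ.hypercubeMap n sqrtn t f s' ≠ 0) :
    ∃ s, f s ≠ 0 ∧ s'.hdeg = s.hdeg + 1 ∧ s'.qdeg = s.qdeg + t := by
  rw [hypercubeMap_apply] at h
  obtain ⟨s, -, hs⟩ := Finset.exists_ne_zero_of_sum_ne_zero h
  exact ⟨s, right_ne_zero_of_mul hs, hdeg_qdeg_of_matrixCoeff_ne_zero (left_ne_zero_of_mul hs)⟩

theorem hypercubeMap_mem_hpart {t : ℕ} {f : Γ.Chain k n} {i : ℤ} (hf : f ∈ Γ.hpart k n i) :
    Γ.hypercubeMap n sqrtn t f ∈ Γ.hpart k n (i + 1) := by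
  intro s' hs'
  obtain ⟨s, hs, h1, -⟩ := exists_of_hypercubeMap_ne_zero hs'
  rw [h1, hf s hs]

theorem hypercubeMap_mem_filt {t : ℕ} {f : Γ.Chain k n} {j : ℤ} (hf : f ∈ Γ.filt k n j) :
    Γ.hypercubeMap n sqrtn t f ∈ Γ.filt k n (j + t) := by
  intro s' hs'
  obtain ⟨s, hs, -, h2⟩ := exists_of_hypercubeMap_ne_zero hs'
  have := hf s hs
  lia

theorem hypercubeMap_mem_bipart {t : ℕ} {f : Γ.Chain k n} {i j : ℤ} (hf : f ∈ Γ.bipart k n i j) :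
    Γ.hypercubeMap n sqrtn t f ∈ Γ.bipart k n (i + 1) (j + t) := by
  intro s' hs'
  obtain ⟨s, hs, h1, h2⟩ := exists_of_hypercubeMap_ne_zero hs'
  rw [h1, h2, (hf s hs).1, (hf s hs).2]
  exact ⟨rfl, rfl⟩

theorem del_mem_bipart {f : Γ.Chain k n} {i j : ℤ} (hf : f ∈ Γ.bipart k n i j) :
    Γ.del n sqrtn f ∈ Γ.bipart k n (i + 1) j := by
  have := hypercubeMap_mem_bipart (sqrtn := sqrtn) (t := 0) hf
  rwa [Nat.cast_zero, add_zero] at this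

theorem delTilde_mem_bipart {f : Γ.Chain k n} {i j : ℤ} (hf : f ∈ Γ.bipart k n i j) :
    Γ.delTilde n sqrtn f ∈ Γ.bipart k n (i + 1) (j + n) :=
  hypercubeMap_mem_bipart hf

theorem delHat_apply_eq (f : Γ.Chain k n) :
    Γ.delHat n sqrtn f = Γ.del n sqrtn f + Γ.delTilde n sqrtn f := rfl

theorem delHat_mem_hpart {f : Γ.Chain k n} {i : ℤ} (hf : f ∈ Γ.hpart k n i) :
    Γ.delHat n sqrtn f ∈ Γ.hpart k n (i + 1) :=
  add_mem (hypercubeMap_mem_hpart hf) (hypercubeMap_mem_hpart hf)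

theorem delTilde_mem_filt {f : Γ.Chain k n} {j : ℤ} (hf : f ∈ Γ.filt k n j) :
    Γ.delTilde n sqrtn f ∈ Γ.filt k n (j + n) := hypercubeMap_mem_filt hf

theorem delHat_mem_filt {f : Γ.Chain k n} {j : ℤ} (hf : f ∈ Γ.filt k n j) :
    Γ.delHat n sqrtn f ∈ Γ.filt k n j :=
  add_mem (filt_antitone (by simp) (hypercubeMap_mem_filt (t := 0) hf))
    (filt_antitone (by lia) (hypercubeMap_mem_filt (t := n) hf))

/-! ### The three identities for the differentials -/

section

variable (hn : 0 < n) (hs : sqrtn * sqrtn = (n : k))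

include hn hs

theorem delHat_delHat (f : Γ.Chain k n) : Γ.delHat n sqrtn (Γ.delHat n sqrtn f) = 0 := by
  rw [delHat_apply, delHat_apply, Matrix.mulVec_mulVec, hatMatrix_mul_hatMatrix hn hs,
    Matrix.zero_mulVec]

/-- The square of `∂̂` has three homogeneous components, each of which vanishes. -/
theorem del_delTilde_identities :
    Γ.del n sqrtn ∘ₗ Γ.del n sqrtn = 0 ∧ Γ.delTilde n sqrtn ∘ₗ Γ.delTilde n sqrtn = 0 ∧
    Γ.delTilde n sqrtn ∘ₗ Γ.del n sqrtn + Γ.del n sqrtn ∘ₗ Γ.delTilde n sqrtn = 0 := by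
  classical
  have key : ∀ s s'' : Γ.EnhancedState n, let f : Γ.Chain k n := Pi.single s 1
      Γ.del n sqrtn (Γ.del n sqrtn f) s'' = 0 ∧
      Γ.delTilde n sqrtn (Γ.delTilde n sqrtn f) s'' = 0 ∧
      (Γ.delTilde n sqrtn (Γ.del n sqrtn f) + Γ.del n sqrtn (Γ.delTilde n sqrtn f)) s'' = 0 := by
    intro s s'' f
    have hf : f ∈ Γ.bipart k n s.hdeg s.qdeg := by
      intro s' hs'
      obtain rfl : s' = s := by
        by_contra hne
        exact hs' (by simp [f, hne])
      exact ⟨rfl, rfl⟩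
    have h0 := del_mem_bipart (sqrtn := sqrtn) (del_mem_bipart (sqrtn := sqrtn) hf) s''
    have h1 := delTilde_mem_bipart (sqrtn := sqrtn) (delTilde_mem_bipart (sqrtn := sqrtn) hf) s''
    have h2 := add_mem (delTilde_mem_bipart (sqrtn := sqrtn) (del_mem_bipart (sqrtn := sqrtn) hf))
      (del_mem_bipart (sqrtn := sqrtn) (delTilde_mem_bipart (sqrtn := sqrtn) hf)) s''
    have hsum := congrFun (delHat_delHat hn hs f) s''
    rw [delHat_apply_eq, delHat_apply_eq, map_add, map_add] at hsum
    simp only [Pi.add_apply, Pi.zero_apply] at hsum h2 ⊢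
    by_cases c0 : s''.qdeg = s.qdeg
    · have e1 := not_imp_comm.1 h1 (by lia)
      have e2 := not_imp_comm.1 h2 (by lia)
      exact ⟨by linear_combination hsum - e1 - e2, e1, e2⟩
    · have e0 := not_imp_comm.1 h0 (by lia)
      by_cases c1 : s''.qdeg = s.qdeg + n
      · have e1 := not_imp_comm.1 h1 (by lia)
        exact ⟨e0, e1, by linear_combination hsum - e0 - e1⟩
      · have e2 := not_imp_comm.1 h2 (by lia)
        exact ⟨e0, by linear_combination hsum - e0 - e2, e2⟩
  refine ⟨?_, ?_, ?_⟩ <;> refine LinearMap.pi_ext' fun s => LinearMap.ext_ring ?_ <;> funext s''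
  · exact (key s s'').1
  · exact (key s s'').2.1
  · exact (key s s'').2.2

end

theorem component_hypercubeMap {t : ℕ} {P Q : Set ℤ} (hPQ : ∀ q : ℤ, q + t ∈ Q ↔ q ∈ P)
    (f : Γ.Chain k n) : Γ.component k n Q (Γ.hypercubeMap n sqrtn t f) =
      Γ.hypercubeMap n sqrtn t (Γ.component k n P f) := by
  funext s'
  by_cases hs' : s'.qdeg ∈ Q
  · rw [component_apply_of_mem hs', hypercubeMap_apply, hypercubeMap_apply]
    refine Finset.sum_congr rfl fun s _ => ?_
    by_cases h : s.qdeg ∈ P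
    · rw [component_apply_of_mem h]
    · rw [component_apply_of_notMem h, mul_zero]
      by_contra hne
      have := (hdeg_qdeg_of_matrixCoeff_ne_zero (left_ne_zero_of_mul hne)).2
      exact h ((hPQ _).1 (this ▸ hs'))
  · rw [component_apply_of_notMem hs']
    by_contra hne
    obtain ⟨s, hs, -, h2⟩ := exists_of_hypercubeMap_ne_zero (Ne.symm hne)
    exact hs' (by rw [h2, hPQ]; exact (component_ne_zero hs).1)

theorem component_singleton_delHat (f : Γ.Chain k n) (j : ℤ) :
    Γ.component k n {j} (Γ.delHat n sqrtn f) = Γ.del n sqrtn (Γ.component k n {j} f) +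
      Γ.delTilde n sqrtn (Γ.component k n {j - n} f) := by
  rw [delHat_apply_eq, map_add]
  congr 1
  · exact component_hypercubeMap (by simp) f
  · refine component_hypercubeMap (fun q => ?_) f
    simp only [Set.mem_singleton_iff]
    lia

/-- In lowest filtration degree, `∂̂` is `∂`. -/
theorem component_singleton_delHat_of_mem_filt {f : Γ.Chain k n} {j : ℤ}
    (hf : f ∈ Γ.filt k n (j - n + 1)) :
    Γ.component k n {j} (Γ.delHat n sqrtn f) = Γ.del n sqrtn (Γ.component k n {j} f) := by
  rw [component_singleton_delHat, (component_singleton_eq_zero_iff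
    (filt_antitone (by lia) hf)).2 hf, map_zero, add_zero]

/-- The quantum degrees that are congruent to `j` modulo `n`. -/
def residueClass (n : ℕ) (j : ℤ) : Set ℤ := {q | (n : ℤ) ∣ q - j}

theorem isResidueSplit (hn : 0 < n) (hs : sqrtn * sqrtn = (n : k)) :
    IsResidueSplit (Γ.delHat n sqrtn) (Γ.hpart k n) (Γ.filt k n) n
      (fun j => Γ.component k n (residueClass n j)) where
  d_d := delHat_delHat hn hs
  d_mem_C := delHat_mem_hpart
  d_mem_F := delHat_mem_filt
  antitone := filt_antitone
  pos := hn
  proj_d j f := by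
    rw [delHat_apply_eq, delHat_apply_eq, map_add]
    congr 1
    · exact component_hypercubeMap (by simp) f
    · refine component_hypercubeMap (fun q => ?_) f
      simp only [residueClass, Set.mem_ofPred_eq, add_sub_right_comm]
      exact dvd_add_self_right
  proj_mem_C _ hf := component_mem_hpart hf
  proj_mem_F _ hf := component_mem_filt hf
  proj_mem_F_add {j f} q hf := by
    intro s hs
    obtain ⟨⟨c, hc⟩, h2⟩ := component_ne_zero hs
    have h3 := hf s h2
    have h4 : (n : ℤ) * q < n * c := by lia
    have h5 := lt_of_mul_lt_mul_left h4 (by positivity)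
    have h6 : (n : ℤ) * (q + 1) ≤ n * c := by gcongr; exact h5
    lia
  sub_proj_mem {j f} hf := by
    intro s hs
    have h0 : f s ≠ 0 := by
      intro h0
      by_cases h : s.qdeg ∈ residueClass n j
      · exact hs (by rw [Pi.sub_apply, component_apply_of_mem h, sub_self])
      · exact hs (by rw [Pi.sub_apply, component_apply_of_notMem h, h0, sub_zero])
    rcases (hf s h0).lt_or_eq with h2 | h2
    · exact h2
    · refine absurd ?_ hs
      have h : s.qdeg ∈ residueClass n j := by simp [residueClass, h2]
      rw [Pi.sub_apply, component_apply_of_mem h, sub_self]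

end PerfectMatchingGraph

namespace PerfectMatchingGraph

variable {V : Type w} {E : Type v} {Γ : PerfectMatchingGraph V E} {k : Type u} [CommRing k]
  {n : ℕ} {sqrtn : k}

/-! ### The pages `E_0` and `E_1`, and the theorem -/

theorem exists_bound_qdeg [Finite E] (Γ : PerfectMatchingGraph V E) (n : ℕ) :
    ∃ b : ℕ, ∀ s : Γ.EnhancedState n, -(b : ℤ) ≤ s.qdeg ∧ s.qdeg ≤ b := by
  refine ⟨∑ s : Γ.EnhancedState n, s.qdeg.natAbs, fun s => ?_⟩
  have := Finset.single_le_sum (f := fun s : Γ.EnhancedState n => s.qdeg.natAbs)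
    (fun _ _ => Nat.zero_le _) (Finset.mem_univ s)
  lia

variable [Fintype E] [LinearOrder E]

/-- The page `E_0` is the associated graded module, by taking the components of degree `j`. -/
noncomputable def pageZeroEquiv (Γ : PerfectMatchingGraph V E) (n : ℕ) (sqrtn : k) (i j : ℤ) :
    FilteredPage (Γ.delHat n sqrtn) (Γ.hpart k n) (Γ.filt k n) n 0 i j ≃ₗ[k] Γ.bipart k n i j :=
  SubQuot.equivOfSurjective
    ((Γ.component k n {j}).restrict fun _ hf =>
      component_singleton_mem_bipart (mem_pageCycles.1 hf).1 j)
    (by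
      intro f
      refine ⟨⟨f, mem_pageCycles.2 ⟨bipart_le_hpart i j f.2, bipart_le_filt i j f.2, ?_⟩⟩,
        Subtype.ext (component_singleton_eq_self f.2)⟩
      rw [zero_mul, add_zero]
      exact delHat_mem_filt (bipart_le_filt i j f.2))
    (by
      intro f
      have hf := mem_pageCycles.1 f.2
      rw [Subtype.ext_iff]
      change Γ.component k n {j} f = 0 ↔ _
      rw [component_singleton_eq_zero_iff hf.2.1, mem_pageBoundaries]
      constructor
      · intro h
        exact ⟨f, ⟨f.2, h⟩, 0, ⟨zero_mem _, zero_mem _⟩, by simp, by simp⟩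
      · rintro ⟨y, ⟨-, hy⟩, w, ⟨-, hw⟩, -, he⟩
        rw [← he]
        rw [zero_mul, sub_zero] at hw
        exact add_mem hy (delHat_mem_filt hw))

theorem delHat_bicycle {i j : ℤ} {z : Γ.Chain k n} (hz : z ∈ Γ.bicycles n sqrtn i j) :
    Γ.delHat n sqrtn z = Γ.delTilde n sqrtn z := by
  rw [delHat_apply_eq, LinearMap.mem_ker.1 hz.1, zero_add]

theorem bicycles_le_pageCycles (i j : ℤ) : Γ.bicycles n sqrtn i j ≤
    pageCycles (Γ.delHat n sqrtn) (Γ.hpart k n) (Γ.filt k n) n 1 i j := by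
  intro z hz
  refine mem_pageCycles.2 ⟨bipart_le_hpart i j hz.2, bipart_le_filt i j hz.2, ?_⟩
  rw [delHat_bicycle hz, one_mul]
  exact delTilde_mem_filt (bipart_le_filt i j hz.2)

/-- The bigraded homology is the page `E_1`: a cycle for `∂` is an element of `Z_1`. -/
noncomputable def homologyEquivPageOne (hn : 0 < n) (hs : sqrtn * sqrtn = (n : k))
    (Γ : PerfectMatchingGraph V E) (i j : ℤ) : Γ.CH n sqrtn i j ≃ₗ[k]
      FilteredPage (Γ.delHat n sqrtn) (Γ.hpart k n) (Γ.filt k n) n 1 i j :=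
  SubQuot.equivOfSurjective
    (Submodule.mkQ _ ∘ₗ Submodule.inclusion (bicycles_le_pageCycles i j))
    (by
      intro c
      obtain ⟨x, rfl⟩ := IsFilteredComplex.pageClass_surjective c
      have hx := mem_pageCycles.1 x.2
      rw [one_mul] at hx
      have hxj : Γ.component k n {j} x ∈ Γ.bicycles n sqrtn i j := by
        refine Submodule.mem_inf.2 ⟨?_, component_singleton_mem_bipart hx.1 j⟩
        rw [LinearMap.mem_ker, ← component_singleton_delHat_of_mem_filt
          (filt_antitone (by lia) hx.2.1), component_singleton_eq_zero_iff
          (filt_antitone (by lia) hx.2.2)]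
        exact filt_antitone (by lia) hx.2.2
      refine ⟨⟨_, hxj⟩, Eq.symm (IsFilteredComplex.pageClass_eq_iff.2
        (mem_pageBoundaries.2 ⟨(x : Γ.Chain k n) - Γ.component k n {j} x,
        ⟨sub_mem x.2 (bicycles_le_pageCycles i j hxj), sub_component_singleton_mem hx.2.1⟩, 0,
        ⟨zero_mem _, zero_mem _⟩, by simp, by simp⟩))⟩)
    (by
      intro z
      have hz := mem_pageCycles.1 (bicycles_le_pageCycles i j z.2)
      refine IsFilteredComplex.pageClass_eq_zero_iff.trans ?_
      change (z : Γ.Chain k n) ∈ _ ↔ _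
      rw [mem_pageBoundaries]
      constructor
      · rintro ⟨y, ⟨-, hy⟩, w, ⟨hw, hw'⟩, hdw, he⟩
        refine ⟨Γ.component k n {j} w, component_singleton_mem_bipart hw j, ?_⟩
        rw [← component_singleton_delHat_of_mem_filt (by rwa [one_mul] at hw'),
          ← component_singleton_eq_self z.2.2, ← he, map_add,
          (component_singleton_eq_zero_iff (filt_antitone (by lia) hy)).2 hy, zero_add]
      · rintro ⟨w, hw, he⟩
        have hwF : w ∈ Γ.filt k n j := bipart_le_filt _ _ hw
        -- `∂ w` and `∂̂ w` differ by `∂̃ w`, which lies in a higher step of the filtration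
        have hw1 : Γ.delTilde n sqrtn w ∈ Γ.filt k n (j + 1) :=
          filt_antitone (by lia) (delTilde_mem_filt hwF)
        have he' : -Γ.delTilde n sqrtn w + Γ.delHat n sqrtn w = z := by
          rw [delHat_apply_eq, he]
          abel
        have he'' : -Γ.delTilde n sqrtn w = z - Γ.delHat n sqrtn w := by
          rw [← he', add_sub_cancel_right]
        refine ⟨-Γ.delTilde n sqrtn w, ⟨mem_pageCycles.2 ⟨?_, ?_, ?_⟩, neg_mem hw1⟩, w,
          ⟨bipart_le_hpart _ _ hw, filt_antitone (by lia) hwF⟩, delHat_mem_filt hwF, he'⟩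
        · refine neg_mem ?_
          have := hypercubeMap_mem_hpart (sqrtn := sqrtn) (t := n) (bipart_le_hpart _ _ hw)
          rwa [sub_add_cancel] at this
        · exact neg_mem (filt_antitone (by lia) hw1)
        · rw [he'', map_sub, delHat_delHat hn hs, sub_zero]
          exact hz.2.2)

end PerfectMatchingGraph

theorem theoremC {V : Type w} {E : Type v} [Fintype E] [LinearOrder E]
    (Γ : PerfectMatchingGraph V E) (hconn : Γ.toRibbonGraph.Connected)
    (n : ℕ) (hn : 0 < n) {k : Type u} [CommRing k] (sqrtn : k) (hsqrtn : sqrtn * sqrtn = (n : k)) :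
    -- `∂` and `∂̃` are anticommuting differentials of bidegrees `(1, 0)` and `(1, n)`
    Γ.del n sqrtn ∘ₗ Γ.del n sqrtn = 0 ∧
    Γ.delTilde n sqrtn ∘ₗ Γ.delTilde n sqrtn = 0 ∧
    Γ.delTilde n sqrtn ∘ₗ Γ.del n sqrtn + Γ.del n sqrtn ∘ₗ Γ.delTilde n sqrtn = 0 ∧
    (∀ i j, (Γ.bipart k n i j).map (Γ.del n sqrtn) ≤ Γ.bipart k n (i + 1) j) ∧
    (∀ i j, (Γ.bipart k n i j).map (Γ.delTilde n sqrtn) ≤ Γ.bipart k n (i + 1) (j + n)) ∧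
    -- hence `∂̂` is a differential that preserves the quantum filtration
    Γ.delHat n sqrtn ∘ₗ Γ.delHat n sqrtn = 0 ∧
    (∀ i, (Γ.hpart k n i).map (Γ.delHat n sqrtn) ≤ Γ.hpart k n (i + 1)) ∧
    (∀ j, (Γ.filt k n j).map (Γ.delHat n sqrtn) ≤ Γ.filt k n j) ∧
    -- the spectral sequence of the filtered complex
    ∃ S : SpectralSequence (ModuleCat.{max u v} k) (colorShape n) 0,
      IsSpectralSequenceOfFiltered (Γ.delHat n sqrtn) (Γ.hpart k n) (Γ.filt k n) n S ∧
      -- the page `E_0` is the bigraded complex with the differential `∂`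
      (∃ φ : ∀ i j : ℤ, (S.page 0).X (i, j) ≃ₗ[k] Γ.bipart k n i j,
        ∀ (i j : ℤ) (x : (S.page 0).X (i, j)),
          (φ (i + 1) j (((S.page 0).d (i, j) (i + 1, j)).hom x) : Γ.Chain k n) =
            Γ.del n sqrtn (φ i j x)) ∧
      -- the page `E_1` is the bigraded `n`-color homology with the differential induced by `∂̃`
      (∃ φ : ∀ i j : ℤ, (S.page 1).X (i, j) ≃ₗ[k] Γ.CH n sqrtn i j,
        ∀ (i j : ℤ) (z : ↥(Γ.bicycles n sqrtn i j)) (z' : ↥(Γ.bicycles n sqrtn (i + 1) (j + n))),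
          (z' : Γ.Chain k n) = Γ.delTilde n sqrtn z →
          φ (i + 1) (j + n) (((S.page 1).d (i, j) (i + 1, j + n)).hom
            ((φ i j).symm (Submodule.Quotient.mk z))) = Submodule.Quotient.mk z') ∧
      -- the pages become stationary, and the stable page `E_∞` is the filtered `n`-color homology
      (∃ N : ℤ, ∀ (r : ℤ) (hr : 0 ≤ r), N ≤ r →
        (∀ a b : ℤ × ℤ, (S.page r hr).d a b = 0) ∧
        (∀ i j : ℤ, Nonempty ((S.page r hr).X (i, j) ≃ₗ[k]
          SubQuot (Γ.CHhatFilt n sqrtn i j) (Γ.CHhatFilt n sqrtn i (j + 1)))) ∧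
        (IsField k → ∀ i : ℤ, Nonempty
          ((DirectSum ℤ fun j => (S.page r hr).X (i, j)) ≃ₗ[k] Γ.CHhat n sqrtn i))) := by
  obtain ⟨h1, h2, h3⟩ := PerfectMatchingGraph.del_delTilde_identities (Γ := Γ) hn hsqrtn
  have h := PerfectMatchingGraph.isResidueSplit (Γ := Γ) hn hsqrtn
  refine ⟨h1, h2, h3, ?_, ?_, LinearMap.ext h.d_d, ?_, ?_, h.spectralSequence,
    h.isSpectralSequenceOfFiltered, ?_, ?_, ?_⟩
  · rintro i j _ ⟨f, hf, rfl⟩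
    exact PerfectMatchingGraph.del_mem_bipart hf
  · rintro i j _ ⟨f, hf, rfl⟩
    exact PerfectMatchingGraph.delTilde_mem_bipart hf
  · rintro i _ ⟨f, hf, rfl⟩
    exact h.d_mem_C hf
  · rintro j _ ⟨f, hf, rfl⟩
    exact h.d_mem_F hf
  · refine ⟨fun i j => Γ.pageZeroEquiv n sqrtn i j, fun i j c => ?_⟩
    obtain ⟨x, rfl⟩ := IsFilteredComplex.pageClass_surjective c
    have hx : (x : Γ.Chain k n) ∈ Γ.filt k n j := (mem_pageCycles.1 x.2).2.1
    have hd : (h.spectralSequence.page 0).d (i, j) (i + 1, j) =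
        ModuleCat.ofHom (h.pageMap rfl (by simp)) :=
      h.page_d (a := (i, j)) (b := (i + 1, j)) rfl (by simp)
    rw [hd]
    exact PerfectMatchingGraph.component_singleton_delHat_of_mem_filt
      (PerfectMatchingGraph.filt_antitone (by omega) hx)
  · refine ⟨fun i j => (Γ.homologyEquivPageOne hn hsqrtn i j).symm, fun i j z z' hz => ?_⟩
    have hd : (h.spectralSequence.page 1).d (i, j) (i + 1, j + n) =
        ModuleCat.ofHom (h.pageMap rfl (by simp)) :=
      h.page_d (a := (i, j)) (b := (i + 1, j + n)) rfl (by simp)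
    rw [hd]
    refine (LinearEquiv.symm_apply_eq _).2 ?_
    refine congrArg (pageClass _ _ _ n) (Subtype.ext ?_)
    exact (PerfectMatchingGraph.delHat_bicycle z.2).trans hz.symm
  · obtain ⟨b, hb⟩ := Γ.exists_bound_qdeg n
    have htop : ∀ j : ℤ, j ≤ -b → Γ.filt k n j = ⊤ := fun j hj =>
      eq_top_iff.2 fun f _ s _ => hj.trans (hb s).1
    have hbot : ∀ j : ℤ, b < j → Γ.filt k n j = ⊥ := by
      intro j hj
      rw [eq_bot_iff]
      intro f hf
      rw [Submodule.mem_bot]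
      funext s
      by_contra hne
      have := hf s hne
      have := (hb s).2
      lia
    refine ⟨2 * b + 1, fun r hr hN => ?_⟩
    have hrn : 2 * (b : ℤ) + 1 ≤ r * n := by
      have : (1 : ℤ) ≤ n := by exact_mod_cast hn
      nlinarith
    refine ⟨fun x y => ?_, fun i j => ?_, fun hk i => ?_⟩
    · by_cases hxy : (colorShape n r).Rel x y
      · obtain ⟨hxy1, hxy2⟩ := Prod.ext_iff.1 hxy
        refine (h.page_d hxy1 hxy2).trans ?_
        rw [h.pageMap_eq_zero htop hbot _ _ hrn]
        rfl
      · exact (h.spectralSequence.page r hr).shape _ _ hxy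
    · exact h.nonempty_page_equiv_graded htop hbot hrn
    · exact h.nonempty_directSum_page_equiv htop hbot hk hrn
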